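/- Let $\Bbbk$ be a field of arbitrary characteristic, $V$ a finite-dimensional $\Bbbk$-vector space, and $G\le GL(V)$ a (possibly infinite) subgroup acting irreducibly on $V$. Let $\mathcal S=\{s\in G:\dim (1-s)V=1\}$ be the set of complex reflections in $G$. A linear map $\delta\colon V\to \Bbbk G\otimes V$, $\delta(v)=\sum_{h\in G}h\otimes L_h(v)$, is called a quasicoaction; it is Yetter--Drinfeld if $g(L_h(v))=L_{ghg^{-1}}(g(v))$ for all $g,h\in G$, $v\in V$. Let $\widetilde A$ be the algebra generated by $V$, the algebra $\Bbbk G$ and $V^*$ (with $1_{\Bbbk G}=1_{\widetilde A}$) subject to $$g v=g(v)\,g,\qquad f g=g\,(f\circ g),\qquad fv-vf=\sum_{h\in G}\langle f,L_h(v)\rangle h\qquad(g\in G,\ v\in V,\ f\in V^*).$$ A $(V,\delta)$-braided double $U^-\rtimes\Bbbk G\ltimes U^+$ consists of a Yetter--Drinfeld quasicoaction $\delta$ and two-sided ideals $I^-\subseteq T^{>0}(V)$, $I^+\subseteq T^{>0}(V^*)$ such that, with $U^-=T(V)/I^-$ and $U^+=T(V^*)/I^+$, the multiplication map $U^-\otimes\Bbbk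 G\otimes U^+\to\widetilde A/\langle I^-,I^+\rangle$ is bijective. For $t\in\Bbbk$ and a finitely supported function $c\colon\mathcal S\to\Bbbk$, $s\mapsto c_s$, with $c_{gsg^{-1}}=c_s$ for all $g\in G$, put $$\delta_{t,c}(v)=1\otimes tv+\sum_{s\in\mathcal S}c_s\,s\otimes(v-s(v)).$$ 1. Assume that $\operatorname{End}_{\Bbbk G}(V)=\Bbbk$ (this is automatic if $\Bbbk$ is algebraically closed or if $\mathcal S\neq\emptyset$). Let $\delta\colon V\to\Bbbk G\otimes V$ be a linear map. There exists a $(V,\delta)$-braided double $U^-\rtimes\Bbbk G\ltimes U^+$ with $U^-$ and $U^+$ both commutative if and only if $\delta=\delta_{t,c}$ for some $t$ and $c$ as above. 2. For all $t$ and $c$ as above (without the assumption on $\operatorname{End}_{\Bbbk G}(V)$), there exists a $(V,\delta_{t,c})$-braided double of the form $S(V)\rtimes\Bbbk G\ltimes S(V^*)$, that is, with $I^-$ and $I^+$ the kernels of $T(V)\to S(V)$ and $T(V^*)\to S(V^*)$. -/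

import Mathlib

open scoped TensorProduct

noncomputable section

namespace BraidedDoubles

/-! ### Quasi-Yetter-Drinfeld modules over a group algebra -/

section General

universe u v w

variable {k : Type u} {G : Type v} {V : Type w} [Field k] [Group G] [AddCommGroup V] [Module k V]

/-- A quasicoaction `δ : V → kG ⊗ V` on a representation `ρ` of `G` is Yetter-Drinfeld compatible
if `(g ▷ v)^[-1] g ⊗ (g ▷ v)^[0] = g v^[-1] ⊗ g ▷ v^[0]` for all group elements `g`
(these are grouplike and span `kG`). -/
def IsYetterDrinfeld (ρ : Representation k G V)
    (δ : V →ₗ[k] MonoidAlgebra k G ⊗[k] V) : Prop :=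
  ∀ (g : G) (v : V),
    (LinearMap.mulRight k (MonoidAlgebra.of k G g)).rTensor V (δ (ρ g v)) =
      TensorProduct.map (LinearMap.mulLeft k (MonoidAlgebra.of k G g)) (ρ g) (δ v)

/-- The `kG`-valued pairing attached to a quasicoaction: `β(f, v) = v^[-1] ⟨f, v^[0]⟩`. -/
def pairing (δ : V →ₗ[k] MonoidAlgebra k G ⊗[k] V) (f : Module.Dual k V) (v : V) :
    MonoidAlgebra k G :=
  TensorProduct.rid k (MonoidAlgebra k G) (f.lTensor (MonoidAlgebra k G) (δ v))

/-! ### The algebra generated by `V`, `kG` and `V*` -/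

/-- The free algebra on the vector space `V ⊕ kG ⊕ V*`. -/
abbrev Gen (k : Type u) (G : Type v) (V : Type w) [Field k] [Group G] [AddCommGroup V]
    [Module k V] :=
  TensorAlgebra k (V × MonoidAlgebra k G × Module.Dual k V)

/-- The generators `v ∈ V`. -/
def genV : V →ₗ[k] Gen k G V :=
  TensorAlgebra.ι k ∘ₗ LinearMap.inl k V (MonoidAlgebra k G × Module.Dual k V)

/-- The generators `h ∈ kG`. -/
def genH : MonoidAlgebra k G →ₗ[k] Gen k G V :=
  TensorAlgebra.ι k ∘ₗ LinearMap.inr k V (MonoidAlgebra k G × Module.Dual k V) ∘ₗ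
    LinearMap.inl k (MonoidAlgebra k G) (Module.Dual k V)

/-- The generators `f ∈ V*`. -/
def genD : Module.Dual k V →ₗ[k] Gen k G V :=
  TensorAlgebra.ι k ∘ₗ LinearMap.inr k V (MonoidAlgebra k G × Module.Dual k V) ∘ₗ
    LinearMap.inr k (MonoidAlgebra k G) (Module.Dual k V)

/-- The defining relations: all relations of the unital algebra `kG`, the semidirect product
relations `g v = (g ▷ v) g` and `f g = g (f ◁ g)` with `⟨f ◁ g, v⟩ = ⟨f, g ▷ v⟩`, and the
commutator relation `f v - v f = β(f, v)`. -/
inductive Rel (ρ : Representation k G V) (δ : V →ₗ[k] MonoidAlgebra k G ⊗[k] V) :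
    Gen k G V → Gen k G V → Prop
  | one : Rel ρ δ (genH 1) 1
  | mul (a b : MonoidAlgebra k G) : Rel ρ δ (genH (a * b)) (genH a * genH b)
  | smash_left (g : G) (v : V) :
      Rel ρ δ (genH (MonoidAlgebra.of k G g) * genV v)
        (genV (ρ g v) * genH (MonoidAlgebra.of k G g))
  | smash_right (f : Module.Dual k V) (g : G) :
      Rel ρ δ (genD f * genH (MonoidAlgebra.of k G g))
        (genH (MonoidAlgebra.of k G g) * genD ((ρ g).dualMap f))
  | comm (f : Module.Dual k V) (v : V) :
      Rel ρ δ (genD f * genV v - genV v * genD f) (genH (pairing δ f v))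

/-- The algebra `Ã` generated by `V`, `kG`, `V*` subject to the defining relations. -/
abbrev ATilde (ρ : Representation k G V) (δ : V →ₗ[k] MonoidAlgebra k G ⊗[k] V) :=
  RingQuot (Rel ρ δ)

/-- The algebra map `T(V) → Ã`. -/
def tildeV (ρ : Representation k G V) (δ : V →ₗ[k] MonoidAlgebra k G ⊗[k] V) :
    TensorAlgebra k V →ₐ[k] ATilde ρ δ :=
  TensorAlgebra.lift k ((RingQuot.mkAlgHom k (Rel ρ δ)).toLinearMap ∘ₗ genV)

/-- The linear map `kG → Ã`. -/
def tildeH (ρ : Representation k G V) (δ : V →ₗ[k] MonoidAlgebra k G ⊗[k] V) :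
    MonoidAlgebra k G →ₗ[k] ATilde ρ δ :=
  (RingQuot.mkAlgHom k (Rel ρ δ)).toLinearMap ∘ₗ genH

/-- The algebra map `T(V*) → Ã`. -/
def tildeD (ρ : Representation k G V) (δ : V →ₗ[k] MonoidAlgebra k G ⊗[k] V) :
    TensorAlgebra k (Module.Dual k V) →ₐ[k] ATilde ρ δ :=
  TensorAlgebra.lift k ((RingQuot.mkAlgHom k (Rel ρ δ)).toLinearMap ∘ₗ genD)

/-! ### Quotients by relations in `T(V)` and in `T(V*)` -/

/-- The relations `x = 0` for `x ∈ I⁻` and `y = 0` for `y ∈ I⁺`. -/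
inductive QRel (ρ : Representation k G V) (δ : V →ₗ[k] MonoidAlgebra k G ⊗[k] V)
    (Im : Ideal (TensorAlgebra k V)) (Ip : Ideal (TensorAlgebra k (Module.Dual k V))) :
    ATilde ρ δ → ATilde ρ δ → Prop
  | minus (x : TensorAlgebra k V) (hx : x ∈ Im) : QRel ρ δ Im Ip (tildeV ρ δ x) 0
  | plus (y : TensorAlgebra k (Module.Dual k V)) (hy : y ∈ Ip) : QRel ρ δ Im Ip (tildeD ρ δ y) 0

/-- The quotient of `Ã` by the two-sided ideal generated by `I⁻` and `I⁺`. -/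
abbrev AQuot (ρ : Representation k G V) (δ : V →ₗ[k] MonoidAlgebra k G ⊗[k] V)
    (Im : Ideal (TensorAlgebra k V)) (Ip : Ideal (TensorAlgebra k (Module.Dual k V))) :=
  RingQuot (QRel ρ δ Im Ip)

section Maps

variable (ρ : Representation k G V) (δ : V →ₗ[k] MonoidAlgebra k G ⊗[k] V)
  (Im : Ideal (TensorAlgebra k V)) (Ip : Ideal (TensorAlgebra k (Module.Dual k V)))

/-- The algebra map `T(V)/I⁻ → Ã/⟨I⁻, I⁺⟩`. -/
def quotV [Im.IsTwoSided] : (TensorAlgebra k V ⧸ Im) →ₐ[k] AQuot ρ δ Im Ip :=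
  Ideal.Quotient.liftₐ Im ((RingQuot.mkAlgHom k (QRel ρ δ Im Ip)).comp (tildeV ρ δ))
    (fun x hx => by
      have h := RingQuot.mkAlgHom_rel k (QRel.minus (ρ := ρ) (δ := δ) (Ip := Ip) x hx)
      simpa using h)

/-- The linear map `kG → Ã/⟨I⁻, I⁺⟩`. -/
def quotH : MonoidAlgebra k G →ₗ[k] AQuot ρ δ Im Ip :=
  (RingQuot.mkAlgHom k (QRel ρ δ Im Ip)).toLinearMap ∘ₗ tildeH ρ δ

/-- The algebra map `T(V*)/I⁺ → Ã/⟨I⁻, I⁺⟩`. -/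
def quotD [Ip.IsTwoSided] :
    (TensorAlgebra k (Module.Dual k V) ⧸ Ip) →ₐ[k] AQuot ρ δ Im Ip :=
  Ideal.Quotient.liftₐ Ip ((RingQuot.mkAlgHom k (QRel ρ δ Im Ip)).comp (tildeD ρ δ))
    (fun y hy => by
      have h := RingQuot.mkAlgHom_rel k (QRel.plus (ρ := ρ) (δ := δ) (Im := Im) y hy)
      simpa using h)

/-- The multiplication map `T(V)/I⁻ ⊗ kG ⊗ T(V*)/I⁺ → Ã/⟨I⁻, I⁺⟩`, `b ⊗ h ⊗ φ ↦ b h φ`. -/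
def mulMap [Im.IsTwoSided] [Ip.IsTwoSided] :
    (TensorAlgebra k V ⧸ Im) ⊗[k]
      (MonoidAlgebra k G ⊗[k] (TensorAlgebra k (Module.Dual k V) ⧸ Ip)) →ₗ[k]
        AQuot ρ δ Im Ip :=
  LinearMap.mul' k (AQuot ρ δ Im Ip) ∘ₗ
    TensorProduct.map (quotV ρ δ Im Ip).toLinearMap
      (LinearMap.mul' k (AQuot ρ δ Im Ip) ∘ₗ
        TensorProduct.map (quotH ρ δ Im Ip) (quotD ρ δ Im Ip).toLinearMap)

end Maps

/-! ### Braided doubles -/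

/-- A `(V, δ)`-braided double over `kG`: the quasicoaction `δ` is Yetter-Drinfeld, `I⁻ ⊆ T^{>0}(V)`
and `I⁺ ⊆ T^{>0}(V*)` are two-sided ideals, and the algebra `Ã/⟨I⁻, I⁺⟩` has triangular
decomposition `T(V)/I⁻ ⋊ kG ⋉ T(V*)/I⁺`. -/
structure BraidedDouble (ρ : Representation k G V)
    (δ : V →ₗ[k] MonoidAlgebra k G ⊗[k] V) where
  yetterDrinfeld : IsYetterDrinfeld ρ δ
  Iminus : Ideal (TensorAlgebra k V)
  Iplus : Ideal (TensorAlgebra k (Module.Dual k V))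
  twoSided_minus : Iminus.IsTwoSided
  twoSided_plus : Iplus.IsTwoSided
  Iminus_le : Iminus ≤ RingHom.ker (TensorAlgebra.algebraMapInv : TensorAlgebra k V →ₐ[k] k)
  Iplus_le : Iplus ≤
    RingHom.ker (TensorAlgebra.algebraMapInv : TensorAlgebra k (Module.Dual k V) →ₐ[k] k)
  triangular : Function.Bijective (mulMap ρ δ Iminus Iplus)

attribute [instance] BraidedDouble.twoSided_minus BraidedDouble.twoSided_plus

namespace BraidedDouble

variable {ρ : Representation k G V} {δ : V →ₗ[k] MonoidAlgebra k G ⊗[k] V}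

/-- The algebra `U⁻ = T(V)/I⁻`. -/
abbrev Uminus (B : BraidedDouble ρ δ) := TensorAlgebra k V ⧸ B.Iminus

/-- The algebra `U⁺ = T(V*)/I⁺`. -/
abbrev Uplus (B : BraidedDouble ρ δ) := TensorAlgebra k (Module.Dual k V) ⧸ B.Iplus

/-- The braided double has the form `S(V) ⋊ kG ⋉ S(V*)`: the ideals `I⁻` and `I⁺` are the
kernels of the canonical maps `T(V) → S(V)` and `T(V*) → S(V*)`. -/
def IsSymmetric (B : BraidedDouble ρ δ) : Prop :=
  B.Iminus = RingHom.ker (SymmetricAlgebra.algHom k V) ∧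
    B.Iplus = RingHom.ker (SymmetricAlgebra.algHom k (Module.Dual k V))

end BraidedDouble

end General

/-! ### Linear groups, complex reflections and the quasicoaction `δ_{t,c}` -/

section LinearGroup

universe u w

variable {k : Type u} {V : Type w} [Field k] [AddCommGroup V] [Module k V]

/-- The natural representation on `V` of a linear group `G ≤ GL(V)`. -/
def naturalRep (G : Subgroup (LinearMap.GeneralLinearGroup k V)) : Representation k G V :=
  (Units.coeHom (Module.End k V)).comp G.subtype

/-- The set of complex reflections in `G`: the `s ∈ G` such that `dim (1 - s) V = 1`. -/
def complexReflections (G : Subgroup (LinearMap.GeneralLinearGroup k V)) : Set G :=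
  {s | Module.finrank k (LinearMap.range (1 - naturalRep G s)) = 1}

/-- A finitely supported function `c` on the set of complex reflections is invariant if
`c_{g s g⁻¹} = c_s` for all `g ∈ G`. -/
def IsConjInvariant (G : Subgroup (LinearMap.GeneralLinearGroup k V))
    (c : complexReflections G →₀ k) : Prop :=
  ∀ (g : G) (s s' : complexReflections G), (s' : G) = g * s * g⁻¹ → c s' = c s

/-- The quasicoaction `δ_{t,c}(v) = 1 ⊗ t v + ∑_s c_s s ⊗ (v - s(v))`. -/
def deltaTC (G : Subgroup (LinearMap.GeneralLinearGroup k V)) (t : k)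
    (c : complexReflections G →₀ k) : V →ₗ[k] MonoidAlgebra k G ⊗[k] V :=
  t • TensorProduct.mk k (MonoidAlgebra k G) V 1 +
    c.sum fun s a =>
      a • (TensorProduct.mk k (MonoidAlgebra k G) V (MonoidAlgebra.of k G s) ∘ₗ
        (1 - naturalRep G s))

end LinearGroup

end BraidedDoubles

end

/-!
In a braided double, `[f, v] = β(f, v) := ∑ ⟨f, L_h(v)⟩ h`. If `v` and `v'` commute, the Jacobi
identity for `f`, `v`, `v'` makes `[β(f, v), v']` symmetric in `v` and `v'`, and the triangular
decomposition turns this into `L_h(v) ⊗ (1 - h) v' = L_h(v') ⊗ (1 - h) v`. Together with the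
analogous identity coming from `[f, f'] = 0`, this says that for `h ≠ 1` the operator `L_h` is a
scalar multiple of `1 - h`, and that the scalar vanishes unless `1 - h` has rank one.

Conversely, under these two symmetries the relations can be realized on `S(V) ⊗ kG ⊗ S(V*)`: `V`
acts by multiplication, `G` diagonally and `V*` by Dunkl operators, which are determined by
`[f, v] = β(f, v)` and their values on `1 ⊗ kG ⊗ S(V*)`. Applying elements of
`Ã/⟨I⁻, I⁺⟩` to `1 ⊗ 1 ⊗ 1` inverts the multiplication map.
-/

noncomputable section

namespace BraidedDoubles

/-! ### Symmetric algebras -/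

section SymmetricAlgebra

variable {R M N P A : Type*} [CommSemiring R] [AddCommMonoid M] [Module R M]
  [AddCommMonoid N] [Module R N] [AddCommMonoid P] [Module R P] [Semiring A] [Algebra R A]

/-- The algebra map out of `S(M)` extending a linear map with pairwise commuting values.
Unlike in `SymmetricAlgebra.lift`, the target need not be commutative. -/
def symmetricLift (j : M →ₗ[R] A) (hj : ∀ m m', Commute (j m) (j m')) :
    SymmetricAlgebra R M →ₐ[R] A :=
  (TensorAlgebra.symRingCon R M).liftₐ (TensorAlgebra.lift R j) <|
    RingCon.ringConGen_le.2 fun _ _ hxy => by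
      induction hxy with
      | mul_comm m m' => simpa [RingCon.ker_apply] using (hj m m').eq

theorem symmetricLift_algHom (j : M →ₗ[R] A) (hj : ∀ m m', Commute (j m) (j m'))
    (x : TensorAlgebra R M) :
    symmetricLift j hj (SymmetricAlgebra.algHom R M x) = TensorAlgebra.lift R j x :=
  rfl

@[simp]
theorem symmetricLift_ι (j : M →ₗ[R] A) (hj : ∀ m m', Commute (j m) (j m')) (m : M) :
    symmetricLift j hj (SymmetricAlgebra.ι R M m) = j m :=
  (symmetricLift_algHom j hj (TensorAlgebra.ι R m)).trans (TensorAlgebra.lift_ι_apply j m)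

theorem symmetricAlgebra_linearMap_ext {φ ψ : SymmetricAlgebra R M →ₗ[R] N}
    (one : φ 1 = ψ 1)
    (ι_mul : ∀ m x, φ x = ψ x →
      φ (SymmetricAlgebra.ι R M m * x) = ψ (SymmetricAlgebra.ι R M m * x)) :
    φ = ψ := by
  suffices h : ∀ x y, φ y = ψ y → φ (x * y) = ψ (x * y) from
    LinearMap.ext fun x => by simpa using h x 1 one
  intro x
  induction x using SymmetricAlgebra.induction with
  | algebraMap r => intro y hy; simp only [← Algebra.smul_def, map_smul, hy]
  | ι m => exact ι_mul m
  | mul x x' hx hx' => intro y hy; simpa only [mul_assoc] using hx _ (hx' y hy)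
  | add x x' hx hx' => intro y hy; simp only [add_mul, map_add, hx y hy, hx' y hy]

theorem lift_eq_zero_of_mem_ker_algHom (j : M →ₗ[R] A) (hj : ∀ m m', Commute (j m) (j m'))
    {x : TensorAlgebra R M} (hx : x ∈ RingHom.ker (SymmetricAlgebra.algHom R M)) :
    TensorAlgebra.lift R j x = 0 := by
  rw [← symmetricLift_algHom j hj, RingHom.mem_ker.1 hx, map_zero]

variable (R M) in
theorem ker_symmetricAlgebra_algHom_le :
    RingHom.ker (SymmetricAlgebra.algHom R M) ≤
      RingHom.ker (TensorAlgebra.algebraMapInv : TensorAlgebra R M →ₐ[R] R) :=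
  fun _ => lift_eq_zero_of_mem_ker_algHom 0 fun _ _ => Commute.all _ _

variable (N) in
/-- Multiplication by the generators of `S(M)` on the free `S(M)`-module `S(M) ⊗ N`. -/
def generatorMul : M →ₗ[R] Module.End R (SymmetricAlgebra R M ⊗[R] N) :=
  LinearMap.rTensorHom N ∘ₗ LinearMap.mul R _ ∘ₗ SymmetricAlgebra.ι R M

@[simp]
theorem generatorMul_tmul (m : M) (x : SymmetricAlgebra R M) (n : N) :
    generatorMul N m (x ⊗ₜ[R] n) = (SymmetricAlgebra.ι R M m * x) ⊗ₜ n :=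
  rfl

theorem generatorMul_commute (m m' : M) :
    Commute (generatorMul (R := R) N m) (generatorMul N m') :=
  TensorProduct.ext' fun x n => by simp [mul_left_comm]

theorem symmetricAlgebra_tensor_ext {φ ψ : SymmetricAlgebra R M ⊗[R] N →ₗ[R] P}
    (one_tmul : ∀ n, φ (1 ⊗ₜ n) = ψ (1 ⊗ₜ n))
    (generatorMul : ∀ m z, φ z = ψ z → φ (generatorMul N m z) = ψ (generatorMul N m z)) :
    φ = ψ := by
  refine TensorProduct.ext' fun x n => ?_
  refine LinearMap.congr_fun (f := φ ∘ₗ (TensorProduct.mk R _ N).flip n)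
    (g := ψ ∘ₗ (TensorProduct.mk R _ N).flip n) ?_ x
  exact symmetricAlgebra_linearMap_ext (one_tmul n) fun m x hx => generatorMul m (x ⊗ₜ n) hx

/-- A linear map out of `N` extends to `S(M) ⊗ N` as soon as the target carries commuting
operators for the generators of `S(M)` to be sent to. -/
def inducedLift (j : M →ₗ[R] Module.End R P) (hj : ∀ m m', Commute (j m) (j m'))
    (φ : N →ₗ[R] P) : SymmetricAlgebra R M ⊗[R] N →ₗ[R] P :=
  TensorProduct.lift (LinearMap.lcomp R P φ ∘ₗ (symmetricLift j hj).toLinearMap)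

@[simp]
theorem inducedLift_one_tmul (j : M →ₗ[R] Module.End R P) (hj : ∀ m m', Commute (j m) (j m'))
    (φ : N →ₗ[R] P) (n : N) : inducedLift j hj φ (1 ⊗ₜ n) = φ n := by
  simp [inducedLift]

@[simp]
theorem inducedLift_generatorMul (j : M →ₗ[R] Module.End R P)
    (hj : ∀ m m', Commute (j m) (j m')) (φ : N →ₗ[R] P) (m : M)
    (z : SymmetricAlgebra R M ⊗[R] N) :
    inducedLift j hj φ (generatorMul N m z) = j m (inducedLift j hj φ z) := by
  induction z using TensorProduct.induction_on with
  | zero => simp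
  | tmul x n => simp [inducedLift]
  | add y z hy hz => simp only [map_add, hy, hz]

/-- The operator `(z, y) ↦ (m z + c(m) y, m y)` on pairs of elements of `S(M) ⊗ N`. -/
def jetMul (c : M →ₗ[R] Module.End R (SymmetricAlgebra R M ⊗[R] N)) :
    M →ₗ[R] Module.End R ((SymmetricAlgebra R M ⊗[R] N) × (SymmetricAlgebra R M ⊗[R] N)) where
  toFun m := LinearMap.prod
    (generatorMul N m ∘ₗ LinearMap.fst R _ _ + c m ∘ₗ LinearMap.snd R _ _)
    (generatorMul N m ∘ₗ LinearMap.snd R _ _)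
  map_add' m m' := LinearMap.ext fun p => Prod.ext
    (by simp [add_add_add_comm]) (by simp)
  map_smul' r m := LinearMap.ext fun p => Prod.ext (by simp) (by simp)

@[simp]
theorem jetMul_apply (c : M →ₗ[R] Module.End R (SymmetricAlgebra R M ⊗[R] N)) (m : M)
    (p : (SymmetricAlgebra R M ⊗[R] N) × (SymmetricAlgebra R M ⊗[R] N)) :
    jetMul c m p = (generatorMul N m p.1 + c m p.2, generatorMul N m p.2) :=
  rfl

section CommutatorExtension

variable (c : M →ₗ[R] Module.End R (SymmetricAlgebra R M ⊗[R] N))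
  (hc : ∀ m m', generatorMul N m * c m' + c m * generatorMul N m' =
    generatorMul N m' * c m + c m' * generatorMul N m)
  (d : N →ₗ[R] SymmetricAlgebra R M ⊗[R] N)

include hc in
theorem jetMul_commute (m m' : M) : Commute (jetMul c m) (jetMul c m') := by
  refine LinearMap.ext fun p => Prod.ext ?_ ?_
  · have := LinearMap.congr_fun (hc m m') p.2
    simp only [LinearMap.add_apply, Module.End.mul_apply] at this
    simp only [Module.End.mul_apply, jetMul_apply, map_add, add_assoc, this]
    rw [← Module.End.mul_apply, (generatorMul_commute m m').eq, Module.End.mul_apply]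
  · exact LinearMap.congr_fun (generatorMul_commute m m') p.2

/-- The operator `D` on `S(M) ⊗ N` with `D(1 ⊗ n) = d(n)` and with prescribed commutators
`[D, m] = c(m)`: the map `z ↦ (D z, z)` intertwines multiplication by `m` with `jetMul c m`. -/
def commutatorExtension : Module.End R (SymmetricAlgebra R M ⊗[R] N) :=
  LinearMap.fst R _ _ ∘ₗ
    inducedLift (jetMul c) (jetMul_commute c hc) (d.prod (TensorProduct.mk R _ N 1))

@[simp]
theorem commutatorExtension_one_tmul (n : N) : commutatorExtension c hc d (1 ⊗ₜ n) = d n := by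
  simp [commutatorExtension]

theorem commutatorExtension_generatorMul (m : M) (z : SymmetricAlgebra R M ⊗[R] N) :
    commutatorExtension c hc d (generatorMul N m z) =
      generatorMul N m (commutatorExtension c hc d z) + c m z := by
  have snd_eq : LinearMap.snd R _ _ ∘ₗ inducedLift (jetMul c) (jetMul_commute c hc)
      (d.prod (TensorProduct.mk R _ N 1)) = LinearMap.id :=
    symmetricAlgebra_tensor_ext (by simp) fun m z hz => by
      simp only [LinearMap.comp_apply, LinearMap.snd_apply, LinearMap.id_apply] at hz
      simp [hz]
  have := LinearMap.congr_fun snd_eq z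
  simp only [LinearMap.comp_apply, LinearMap.snd_apply, LinearMap.id_apply] at this
  simp [commutatorExtension, this]

end CommutatorExtension

section InducedRepresentation

variable {G : Type*} [Monoid G] (ρ : Representation R G M) (γ : Representation R G N)

/-- The diagonal action of `G` on `S(M) ⊗ N`. -/
def inducedRep : Representation R G (SymmetricAlgebra R M ⊗[R] N) where
  toFun g := inducedLift (generatorMul N ∘ₗ ρ g) (fun _ _ => generatorMul_commute _ _)
    (TensorProduct.mk R _ N 1 ∘ₗ γ g)
  map_one' := symmetricAlgebra_tensor_ext (by simp) fun m z hz => by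
    rw [inducedLift_generatorMul, hz]
    simp
  map_mul' g h := symmetricAlgebra_tensor_ext (by simp) fun m z hz => by
    rw [inducedLift_generatorMul, hz]
    simp

@[simp]
theorem inducedRep_one_tmul (g : G) (n : N) : inducedRep ρ γ g (1 ⊗ₜ n) = 1 ⊗ₜ γ g n :=
  inducedLift_one_tmul _ _ _ n

@[simp]
theorem inducedRep_generatorMul (g : G) (m : M) (z : SymmetricAlgebra R M ⊗[R] N) :
    inducedRep ρ γ g (generatorMul N m z) = generatorMul N (ρ g m) (inducedRep ρ γ g z) :=
  inducedLift_generatorMul _ _ _ m z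

end InducedRepresentation

end SymmetricAlgebra

theorem mul_comm_quotient_of_eq_ker_algHom {R M : Type*} [CommRing R] [AddCommGroup M]
    [Module R M] {I : Ideal (TensorAlgebra R M)} [I.IsTwoSided]
    (hI : I = RingHom.ker (SymmetricAlgebra.algHom R M)) (x y : TensorAlgebra R M ⧸ I) :
    x * y = y * x := by
  subst hI
  exact (Ideal.quotientKerAlgEquivOfSurjective
    (SymmetricAlgebra.algHom_surjective R M)).injective <| by simp only [map_mul, mul_comm]

/-! ### Coefficients at group elements -/

section Coefficients

variable {k G W : Type*} [CommSemiring k] [AddCommMonoid W] [Module k W]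

open scoped Classical in
/-- The components `w_h` of an element `∑ h ⊗ w_h` of `kG ⊗ W`, as a finitely supported function
of `h`. -/
def tensorFinsuppEquiv : MonoidAlgebra k G ⊗[k] W ≃ₗ[k] G →₀ W :=
  (MonoidAlgebra.coeffLinearEquiv k).rTensor W ≪≫ₗ TensorProduct.finsuppScalarLeft k W G

/-- The component at `h` of an element of `kG ⊗ W`. -/
def tensorCoeff (h : G) : MonoidAlgebra k G ⊗[k] W →ₗ[k] W :=
  Finsupp.lapply h ∘ₗ tensorFinsuppEquiv.toLinearMap

@[simp]
theorem tensorCoeff_tmul (h : G) (a : MonoidAlgebra k G) (w : W) :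
    tensorCoeff h (a ⊗ₜ[k] w) = a.coeff h • w := by
  classical exact TensorProduct.finsuppScalarLeft_apply_tmul_apply _ _ _

theorem tensorCoeff_ext {z z' : MonoidAlgebra k G ⊗[k] W}
    (h : ∀ g, tensorCoeff g z = tensorCoeff g z') : z = z' :=
  tensorFinsuppEquiv.injective (Finsupp.ext h)

theorem finite_setOf_tensorCoeff_ne_zero (z : MonoidAlgebra k G ⊗[k] W) :
    {h : G | tensorCoeff h z ≠ 0}.Finite :=
  (tensorFinsuppEquiv z).hasFiniteSupport

theorem tensorCoeff_lTensor {W' : Type*} [AddCommMonoid W'] [Module k W'] (φ : W →ₗ[k] W')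
    (z : MonoidAlgebra k G ⊗[k] W) (h : G) :
    tensorCoeff h (φ.lTensor (MonoidAlgebra k G) z) = φ (tensorCoeff h z) := by
  induction z using TensorProduct.induction_on with
  | zero => simp
  | tmul a w => simp
  | add y z hy hz => simp only [map_add, hy, hz]

theorem coeff_rid (z : MonoidAlgebra k G ⊗[k] k) (h : G) :
    (TensorProduct.rid k (MonoidAlgebra k G) z).coeff h = tensorCoeff h z := by
  induction z using TensorProduct.induction_on with
  | zero => simp
  | tmul a r => simp [mul_comm]
  | add y z hy hz => simp only [map_add, MonoidAlgebra.coeff_add, Finsupp.add_apply, hy, hz]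

variable [Monoid G]

theorem groupAlgebra_hom_ext {φ ψ : MonoidAlgebra k G →ₗ[k] W}
    (h : ∀ g, φ (MonoidAlgebra.of k G g) = ψ (MonoidAlgebra.of k G g)) : φ = ψ :=
  (MonoidAlgebra.basis G k).ext fun g => by simpa using h g

theorem map_eq_sum_coeff_smul (φ : MonoidAlgebra k G →ₗ[k] W) (a : MonoidAlgebra k G)
    {S : Finset G} (hS : a.coeff.support ⊆ S) :
    φ a = ∑ h ∈ S, a.coeff h • φ (MonoidAlgebra.of k G h) := by
  calc φ a = a.coeff.sum fun h r => r • φ (MonoidAlgebra.of k G h) := by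
        conv_lhs => rw [← MonoidAlgebra.sum_coeff_single a, map_finsuppSum]
        simp [← map_smul]
    _ = _ := Finsupp.sum_of_support_subset _ hS _ (by simp)

end Coefficients

/-! ### Components of a quasicoaction -/

section Components

variable {k G V : Type*} [Field k] [AddCommGroup V] [Module k V]

/-- The operators `L_h` of a quasicoaction `δ(v) = ∑ h ⊗ L_h(v)`. -/
def component (δ : V →ₗ[k] MonoidAlgebra k G ⊗[k] V) (h : G) : Module.End k V :=
  tensorCoeff h ∘ₗ δ

variable (δ : V →ₗ[k] MonoidAlgebra k G ⊗[k] V)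

variable {δ} in
theorem component_ext {δ' : V →ₗ[k] MonoidAlgebra k G ⊗[k] V}
    (h : ∀ g, component δ g = component δ' g) : δ = δ' :=
  LinearMap.ext fun v => tensorCoeff_ext fun g => LinearMap.congr_fun (h g) v

theorem finite_setOf_component_ne_zero [Module.Finite k V] :
    {h : G | component δ h ≠ 0}.Finite := by
  obtain ⟨S, hS⟩ := Module.Finite.fg_top (R := k) (M := V)
  refine (S.finite_toSet.biUnion fun v _ => finite_setOf_tensorCoeff_ne_zero (δ v)).subset ?_
  intro h hh
  by_contra hv
  simp only [Set.mem_iUnion, Set.mem_ofPred_eq, not_exists, not_not] at hv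
  exact hh (LinearMap.ext_on hS hv)

theorem coeff_pairing (f : Module.Dual k V) (v : V) (h : G) :
    (pairing δ f v).coeff h = f (component δ h v) :=
  (coeff_rid _ h).trans (tensorCoeff_lTensor f (δ v) h)

/-- The pairing `β` attached to a quasicoaction, as a bilinear map. -/
def pairingBilin : Module.Dual k V →ₗ[k] V →ₗ[k] MonoidAlgebra k G :=
  LinearMap.mk₂ k (pairing δ) (fun _ _ _ => by ext; simp [coeff_pairing])
    (fun _ _ _ => by ext; simp [coeff_pairing]) (fun _ _ _ => by ext; simp [coeff_pairing])
    (fun _ _ _ => by ext; simp [coeff_pairing])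

variable {δ} [Group G] {ρ : Representation k G V}

theorem tensorCoeff_rTensor_mulRight_of {W : Type*} [AddCommGroup W] [Module k W] (g h : G)
    (z : MonoidAlgebra k G ⊗[k] W) :
    tensorCoeff h ((LinearMap.mulRight k (MonoidAlgebra.of k G g)).rTensor W z) =
      tensorCoeff (h * g⁻¹) z := by
  induction z using TensorProduct.induction_on with
  | zero => simp
  | tmul a w => simp [MonoidAlgebra.coeff_mul_single_apply]
  | add a b ha hb => simp only [map_add, ha, hb]

theorem tensorCoeff_map_mulLeft_of {W W' : Type*} [AddCommGroup W] [Module k W]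
    [AddCommGroup W'] [Module k W'] (g h : G) (φ : W →ₗ[k] W') (z : MonoidAlgebra k G ⊗[k] W) :
    tensorCoeff h (TensorProduct.map (LinearMap.mulLeft k (MonoidAlgebra.of k G g)) φ z) =
      φ (tensorCoeff (g⁻¹ * h) z) := by
  induction z using TensorProduct.induction_on with
  | zero => simp
  | tmul a w => simp [MonoidAlgebra.coeff_single_mul_apply]
  | add a b ha hb => simp only [map_add, ha, hb]

theorem isYetterDrinfeld_iff :
    IsYetterDrinfeld ρ δ ↔
      ∀ g h, ρ g * component δ h = component δ (g * h * g⁻¹) * ρ g := by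
  constructor
  · intro hδ g h
    ext v
    have := congrArg (tensorCoeff (g * h)) (hδ g v)
    rw [tensorCoeff_rTensor_mulRight_of, tensorCoeff_map_mulLeft_of, inv_mul_cancel_left] at this
    exact this.symm
  · intro hL g v
    refine tensorCoeff_ext fun h => ?_
    have := LinearMap.congr_fun (hL g (g⁻¹ * h)) v
    rw [mul_inv_cancel_left] at this
    rw [tensorCoeff_rTensor_mulRight_of, tensorCoeff_map_mulLeft_of]
    exact this.symm

theorem IsYetterDrinfeld.pairing_mul_of (hδ : IsYetterDrinfeld ρ δ) (g : G)
    (f : Module.Dual k V) (v : V) :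
    pairing δ f (ρ g v) * MonoidAlgebra.of k G g =
      MonoidAlgebra.of k G g * pairing δ ((ρ g).dualMap f) v := by
  ext h
  have := LinearMap.congr_fun (isYetterDrinfeld_iff.1 hδ g (g⁻¹ * h)) v
  rw [mul_inv_cancel_left] at this
  simpa [MonoidAlgebra.coeff_mul_single_apply, MonoidAlgebra.coeff_single_mul_apply, coeff_pairing]
    using congrArg f this.symm

end Components

/-! ### Symmetry of commutators -/

section Commutators

variable {k G W X : Type*} [CommRing k] [Monoid G] [AddCommGroup W] [Module k W]
  [AddCommGroup X] [Module k X]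

/-- The condition on `b : W → kG` under which adjoining to `kG ⋉ T(W)`, where `w h = h σ_h(w)`
or `h w = σ_h(w) h`, an element `x` with `[x, w] = b(w)` is compatible with the commutativity
of `W`: the value of `[x, w w']` prescribed by `b` is symmetric in `w` and `w'`. -/
def HasSymmetricCommutators (σ : G → Module.End k W) (b : W → MonoidAlgebra k G) : Prop :=
  ∀ h w w', (b w).coeff h • (w' - σ h w') = (b w').coeff h • (w - σ h w)

variable {σ : G → Module.End k W} {b : W → MonoidAlgebra k G}
  {L R : W →ₗ[k] MonoidAlgebra k G →ₗ[k] X}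

theorem HasSymmetricCommutators.sub_comm (hb : HasSymmetricCommutators σ b)
    (hLR : ∀ g w, L w (MonoidAlgebra.of k G g) = R (σ g w) (MonoidAlgebra.of k G g)) (w w' : W) :
    L w' (b w) - R w' (b w) = L w (b w') - R w (b w') := by
  classical
  set S := (b w).coeff.support ∪ (b w').coeff.support
  have expand : ∀ w₁ w₂ : W, (b w₁).coeff.support ⊆ S → L w₂ (b w₁) - R w₂ (b w₁) =
      ∑ h ∈ S, -R ((b w₁).coeff h • (w₂ - σ h w₂)) (MonoidAlgebra.of k G h) := by
    intro w₁ w₂ hS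
    rw [← LinearMap.sub_apply, map_eq_sum_coeff_smul _ _ hS]
    refine Finset.sum_congr rfl fun h _ => ?_
    simp only [LinearMap.sub_apply, hLR, map_smul, map_sub, LinearMap.smul_apply, smul_sub, neg_sub]
  rw [expand w w' Finset.subset_union_left, expand w' w Finset.subset_union_right]
  simp only [hb _ w w']

theorem HasSymmetricCommutators.mul_add_mul_comm {A : Type*} [Ring A] [Algebra k A]
    (hb : HasSymmetricCommutators σ b) {j : W →ₗ[k] A} {γ : MonoidAlgebra k G →ₗ[k] A}
    (hj : ∀ g w,
      γ (MonoidAlgebra.of k G g) * j w = j (σ g w) * γ (MonoidAlgebra.of k G g)) (w w' : W) :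
    j w * γ (b w') + γ (b w) * j w' = j w' * γ (b w) + γ (b w') * j w := by
  have := hb.sub_comm (L := ((LinearMap.mul k A).flip ∘ₗ j).compl₂ γ)
    (R := (LinearMap.mul k A ∘ₗ j).compl₂ γ) hj w w'
  rw [add_comm, add_comm (j w' * _)]
  exact sub_eq_sub_iff_add_eq_add.1 this

theorem HasSymmetricCommutators.mul_add_mul_comm' {A : Type*} [Ring A] [Algebra k A]
    (hb : HasSymmetricCommutators σ b) {j : W →ₗ[k] A} {γ : MonoidAlgebra k G →ₗ[k] A}
    (hj : ∀ g w,
      j w * γ (MonoidAlgebra.of k G g) = γ (MonoidAlgebra.of k G g) * j (σ g w)) (w w' : W) :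
    γ (b w) * j w' + j w * γ (b w') = γ (b w') * j w + j w' * γ (b w) := by
  have := hb.sub_comm (L := (LinearMap.mul k A ∘ₗ j).compl₂ γ)
    (R := ((LinearMap.mul k A).flip ∘ₗ j).compl₂ γ) hj w w'
  rw [eq_comm, add_comm, add_comm (γ (b w) * _)]
  exact sub_eq_sub_iff_add_eq_add.1 this

theorem hasSymmetricCommutators_of_sub_comm {Y : Type*} [AddCommGroup Y] [Module k Y]
    (hLR : ∀ g w, L w (MonoidAlgebra.of k G g) = R (σ g w) (MonoidAlgebra.of k G g))
    (hsub : ∀ w w', L w' (b w) - R w' (b w) = L w (b w') - R w (b w'))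
    {ι : W →ₗ[k] Y} (hι : Function.Injective ι) (π : G → X →ₗ[k] Y)
    (hπ : ∀ h w a, π h (R w a) = a.coeff h • ι w) :
    HasSymmetricCommutators σ b := by
  classical
  have hπL : ∀ h w a, π h (L w a) = a.coeff h • ι (σ h w) := fun h w a => by
    have : π h ∘ₗ L w = (Finsupp.lapply h ∘ₗ
        (MonoidAlgebra.coeffLinearEquiv k).toLinearMap).smulRight (ι (σ h w)) :=
      groupAlgebra_hom_ext fun g => by
        simp only [LinearMap.comp_apply, LinearMap.smulRight_apply, hLR, hπ]
        by_cases hg : g = h <;> simp [hg]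
    exact LinearMap.congr_fun this a
  intro h w w'
  apply hι
  have := congrArg (π h) (hsub w w')
  simp only [map_sub, hπ, hπL] at this
  simp only [map_smul, map_sub, smul_sub]
  rw [← neg_inj, neg_sub, neg_sub]
  exact this

end Commutators

/-! ### Dunkl operators -/

section Dunkl

variable {k G V N : Type*} [Field k] [Group G] [AddCommGroup V] [Module k V]
  [AddCommGroup N] [Module k N] {ρ : Representation k G V}
  {δ : V →ₗ[k] MonoidAlgebra k G ⊗[k] V} (γ : Representation k G N)
  (hV : ∀ f, HasSymmetricCommutators ρ (pairing δ f))
  (d : Module.Dual k V →ₗ[k] Module.End k N)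

theorem asAlgebraHom_inducedRep_one_tmul (a : MonoidAlgebra k G) (n : N) :
    (inducedRep ρ γ).asAlgebraHom a (1 ⊗ₜ n) = 1 ⊗ₜ γ.asAlgebraHom a n := by
  have : LinearMap.applyₗ (1 ⊗ₜ n) ∘ₗ (inducedRep ρ γ).asAlgebraHom.toLinearMap =
      TensorProduct.mk k _ N 1 ∘ₗ LinearMap.applyₗ n ∘ₗ γ.asAlgebraHom.toLinearMap :=
    groupAlgebra_hom_ext fun g => by simp
  exact LinearMap.congr_fun this a

variable (ρ δ) in
/-- The action of the elements `β(f, v)` of `kG` on `S(V) ⊗ N`. -/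
def pairingAction :
    Module.Dual k V →ₗ[k] V →ₗ[k] Module.End k (SymmetricAlgebra k V ⊗[k] N) :=
  (pairingBilin δ).compr₂ (inducedRep ρ γ).asAlgebraHom.toLinearMap

theorem pairingAction_apply (f : Module.Dual k V) (v : V) :
    pairingAction ρ δ γ f v = (inducedRep ρ γ).asAlgebraHom (pairing δ f v) :=
  rfl

include hV in
theorem generatorMul_mul_pairingAction_add_symm (f : Module.Dual k V) (v w : V) :
    generatorMul N v * pairingAction ρ δ γ f w + pairingAction ρ δ γ f v * generatorMul N w =
      generatorMul N w * pairingAction ρ δ γ f v + pairingAction ρ δ γ f w * generatorMul N v := by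
  have smash : ∀ g v, (inducedRep ρ γ).asAlgebraHom.toLinearMap (MonoidAlgebra.of k G g) *
      generatorMul N v = generatorMul N (ρ g v) *
        (inducedRep ρ γ).asAlgebraHom.toLinearMap (MonoidAlgebra.of k G g) :=
    fun g v => LinearMap.ext fun z => by simp
  have := (hV f).mul_add_mul_comm (A := Module.End k (SymmetricAlgebra k V ⊗[k] N)) smash v w
  exact this

/-- The Dunkl operators: the operators on `S(V) ⊗ N` that extend a given action of `V*`
on `1 ⊗ N` and satisfy `[f, v] = β(f, v)`. -/
def dunkl : Module.Dual k V →ₗ[k] Module.End k (SymmetricAlgebra k V ⊗[k] N) where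
  toFun f := commutatorExtension (pairingAction ρ δ γ f)
    (generatorMul_mul_pairingAction_add_symm γ hV f) (TensorProduct.mk k _ N 1 ∘ₗ d f)
  map_add' f f' := symmetricAlgebra_tensor_ext
    (fun n => by simp [TensorProduct.tmul_add]) fun v z hz => by
      rw [commutatorExtension_generatorMul, hz]
      simp only [commutatorExtension_generatorMul, map_add, LinearMap.add_apply]
      abel
  map_smul' r f := symmetricAlgebra_tensor_ext (fun n => by simp) fun v z hz => by
    rw [commutatorExtension_generatorMul, hz]
    simp [commutatorExtension_generatorMul]

@[simp]
theorem dunkl_one_tmul (f : Module.Dual k V) (n : N) :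
    dunkl γ hV d f (1 ⊗ₜ n) = 1 ⊗ₜ d f n :=
  commutatorExtension_one_tmul _ (generatorMul_mul_pairingAction_add_symm γ hV f) _ n

theorem dunkl_generatorMul (f : Module.Dual k V) (v : V) (z : SymmetricAlgebra k V ⊗[k] N) :
    dunkl γ hV d f (generatorMul N v z) =
      generatorMul N v (dunkl γ hV d f z) + pairingAction ρ δ γ f v z :=
  commutatorExtension_generatorMul _ (generatorMul_mul_pairingAction_add_symm γ hV f) _ v z

variable {γ d} (hδ : IsYetterDrinfeld ρ δ) (hγ : ∀ f g, d f * γ g = γ g * d ((ρ g).dualMap f))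

include hδ in
theorem pairingAction_mul_inducedRep (f : Module.Dual k V) (g : G) (v : V) :
    pairingAction ρ δ γ f (ρ g v) * inducedRep ρ γ g =
      inducedRep ρ γ g * pairingAction ρ δ γ ((ρ g).dualMap f) v := by
  simpa [pairingAction_apply] using
    congrArg (inducedRep ρ γ).asAlgebraHom (hδ.pairing_mul_of g f v)

include hδ hγ in
theorem dunkl_mul_inducedRep (f : Module.Dual k V) (g : G) :
    dunkl γ hV d f * inducedRep ρ γ g =
      inducedRep ρ γ g * dunkl γ hV d ((ρ g).dualMap f) := by
  refine symmetricAlgebra_tensor_ext (fun n => ?_) fun v z hz => ?_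
  · simpa using congrArg (1 ⊗ₜ[k] ·) (LinearMap.congr_fun (hγ f g) n)
  · have hβ := LinearMap.congr_fun (pairingAction_mul_inducedRep (γ := γ) hδ f g v) z
    simp only [Module.End.mul_apply] at hz hβ ⊢
    simp only [inducedRep_generatorMul, dunkl_generatorMul, hz, map_add, hβ]

include hδ hγ in
theorem dunkl_commute (hD : ∀ v, HasSymmetricCommutators (fun h => (ρ h).dualMap) (pairing δ · v))
    (hd : ∀ f f', Commute (d f) (d f')) (f f' : Module.Dual k V) :
    Commute (dunkl γ hV d f) (dunkl γ hV d f') := by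
  have hβ : ∀ v, pairingAction ρ δ γ f v * dunkl γ hV d f' +
      dunkl γ hV d f * pairingAction ρ δ γ f' v =
      pairingAction ρ δ γ f' v * dunkl γ hV d f +
        dunkl γ hV d f' * pairingAction ρ δ γ f v := by
    intro v
    have smash : ∀ g f, dunkl γ hV d f *
        (inducedRep ρ γ).asAlgebraHom.toLinearMap (MonoidAlgebra.of k G g) =
        (inducedRep ρ γ).asAlgebraHom.toLinearMap (MonoidAlgebra.of k G g) *
          dunkl γ hV d ((ρ g).dualMap f) := fun g f => by
      simpa using dunkl_mul_inducedRep hV hδ hγ f g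
    have := (hD v).mul_add_mul_comm' (A := Module.End k (SymmetricAlgebra k V ⊗[k] N)) smash f f'
    exact this
  refine symmetricAlgebra_tensor_ext (fun n => ?_) fun v z hz => ?_
  · simpa using congrArg (1 ⊗ₜ[k] ·) (LinearMap.congr_fun (hd f f').eq n)
  · have := LinearMap.congr_fun (hβ v) z
    simp only [LinearMap.add_apply, Module.End.mul_apply] at hz this ⊢
    simp only [dunkl_generatorMul, map_add, hz, add_assoc, this]

end Dunkl

/-! ### Realizations of the defining relations -/

/-- Maps from `V`, `kG` and `V*` to an algebra `R` that satisfy the defining relations of `Ã`. -/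
structure Realization {k G V : Type*} [Field k] [Group G] [AddCommGroup V] [Module k V]
    (ρ : Representation k G V) (δ : V →ₗ[k] MonoidAlgebra k G ⊗[k] V)
    (R : Type*) [Ring R] [Algebra k R] where
  toV : V →ₗ[k] R
  toH : MonoidAlgebra k G →ₐ[k] R
  toD : Module.Dual k V →ₗ[k] R
  smash_left (g : G) (v : V) :
    toH (MonoidAlgebra.of k G g) * toV v = toV (ρ g v) * toH (MonoidAlgebra.of k G g)
  smash_right (f : Module.Dual k V) (g : G) :
    toD f * toH (MonoidAlgebra.of k G g) =
      toH (MonoidAlgebra.of k G g) * toD ((ρ g).dualMap f)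
  comm (f : Module.Dual k V) (v : V) : toD f * toV v = toV v * toD f + toH (pairing δ f v)

section Quotient

variable {k G V R : Type*} [Field k] [Group G] [AddCommGroup V] [Module k V] [Ring R] [Algebra k R]
  (ρ : Representation k G V) (δ : V →ₗ[k] MonoidAlgebra k G ⊗[k] V)
  (Im : Ideal (TensorAlgebra k V)) (Ip : Ideal (TensorAlgebra k (Module.Dual k V)))

/-- The quotient map from the free algebra on `V ⊕ kG ⊕ V*` to `Ã/⟨I⁻, I⁺⟩`. -/
def mkQuot : Gen k G V →ₐ[k] AQuot ρ δ Im Ip :=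
  (RingQuot.mkAlgHom k (QRel ρ δ Im Ip)).comp (RingQuot.mkAlgHom k (Rel ρ δ))

variable {ρ δ} in
theorem mkQuot_eq_of_rel {x y : Gen k G V} (h : Rel ρ δ x y) :
    mkQuot ρ δ Im Ip x = mkQuot ρ δ Im Ip y :=
  congrArg (RingQuot.mkAlgHom k (QRel ρ δ Im Ip)) (RingQuot.mkAlgHom_rel k h)

/-- The tautological realization in `Ã/⟨I⁻, I⁺⟩`. -/
def quotRealization : Realization ρ δ (AQuot ρ δ Im Ip) where
  toV := (mkQuot ρ δ Im Ip).toLinearMap ∘ₗ genV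
  toH := AlgHom.ofLinearMap (quotH ρ δ Im Ip)
    ((mkQuot_eq_of_rel Im Ip Rel.one).trans (map_one _))
    fun a b => (mkQuot_eq_of_rel Im Ip (Rel.mul a b)).trans (map_mul _ _ _)
  toD := (mkQuot ρ δ Im Ip).toLinearMap ∘ₗ genD
  smash_left g v := (map_mul _ _ _).symm.trans <|
    (mkQuot_eq_of_rel Im Ip (Rel.smash_left g v)).trans (map_mul _ _ _)
  smash_right f g := (map_mul _ _ _).symm.trans <|
    (mkQuot_eq_of_rel Im Ip (Rel.smash_right f g)).trans (map_mul _ _ _)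
  comm f v := by
    have : mkQuot ρ δ Im Ip (genH (pairing δ f v)) = _ :=
      (mkQuot_eq_of_rel Im Ip (Rel.comm f v)).symm
    rw [map_sub, map_mul, map_mul, eq_sub_iff_add_eq'] at this
    exact this.symm

theorem quotV_mk [Im.IsTwoSided] (x : TensorAlgebra k V) :
    quotV ρ δ Im Ip (Ideal.Quotient.mk Im x) =
      TensorAlgebra.lift k (quotRealization ρ δ Im Ip).toV x := by
  have : (RingQuot.mkAlgHom k (QRel ρ δ Im Ip)).comp (tildeV ρ δ) =
      TensorAlgebra.lift k (quotRealization ρ δ Im Ip).toV :=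
    TensorAlgebra.hom_ext <| LinearMap.ext fun v => by
      simp [tildeV, quotRealization, mkQuot]
  exact AlgHom.congr_fun this x

theorem quotD_mk [Ip.IsTwoSided] (y : TensorAlgebra k (Module.Dual k V)) :
    quotD ρ δ Im Ip (Ideal.Quotient.mk Ip y) =
      TensorAlgebra.lift k (quotRealization ρ δ Im Ip).toD y := by
  have : (RingQuot.mkAlgHom k (QRel ρ δ Im Ip)).comp (tildeD ρ δ) =
      TensorAlgebra.lift k (quotRealization ρ δ Im Ip).toD :=
    TensorAlgebra.hom_ext <| LinearMap.ext fun f => by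
      simp [tildeD, quotRealization, mkQuot]
  exact AlgHom.congr_fun this y

theorem quotV_ι [Im.IsTwoSided] (v : V) :
    quotV ρ δ Im Ip (Ideal.Quotient.mk Im (TensorAlgebra.ι k v)) =
      (quotRealization ρ δ Im Ip).toV v :=
  (quotV_mk ..).trans (TensorAlgebra.lift_ι_apply _ v)

theorem quotD_ι [Ip.IsTwoSided] (f : Module.Dual k V) :
    quotD ρ δ Im Ip (Ideal.Quotient.mk Ip (TensorAlgebra.ι k f)) =
      (quotRealization ρ δ Im Ip).toD f :=
  (quotD_mk ..).trans (TensorAlgebra.lift_ι_apply _ f)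

variable {ρ δ Im Ip}

@[elab_as_elim]
theorem quotRealization_induction {motive : AQuot ρ δ Im Ip → Prop}
    (toV : ∀ v, motive ((quotRealization ρ δ Im Ip).toV v))
    (toH : ∀ a, motive ((quotRealization ρ δ Im Ip).toH a))
    (toD : ∀ f, motive ((quotRealization ρ δ Im Ip).toD f))
    (mul : ∀ x y, motive x → motive y → motive (x * y))
    (add : ∀ x y, motive x → motive y → motive (x + y)) (x : AQuot ρ δ Im Ip) : motive x := by
  obtain ⟨x, rfl⟩ := (RingQuot.mkAlgHom_surjective k (QRel ρ δ Im Ip)).comp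
    (RingQuot.mkAlgHom_surjective k (Rel ρ δ)) x
  change motive (mkQuot ρ δ Im Ip x)
  induction x using TensorAlgebra.induction with
  | algebraMap r => simpa only [AlgHom.commutes] using toH (algebraMap k _ r)
  | ι p =>
    have : TensorAlgebra.ι k p = genV p.1 + (genH p.2.1 + genD p.2.2) := by
      simp [genV, genH, genD, ← map_add]
    rw [this, map_add, map_add]
    exact add _ _ (toV p.1) (add _ _ (toH p.2.1) (toD p.2.2))
  | mul x y hx hy => simpa only [map_mul] using mul _ _ hx hy
  | add x y hx hy => simpa only [map_add] using add _ _ hx hy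

namespace Realization

variable (r : Realization ρ δ R)

/-- The algebra map out of the free algebra on `V ⊕ kG ⊕ V*` given by a realization. -/
def liftGen : Gen k G V →ₐ[k] R :=
  TensorAlgebra.lift k (r.toV.coprod (r.toH.toLinearMap.coprod r.toD))

@[simp]
theorem liftGen_genV (v : V) : r.liftGen (genV v) = r.toV v := by simp [liftGen, genV]

@[simp]
theorem liftGen_genH (a : MonoidAlgebra k G) : r.liftGen (genH a) = r.toH a := by
  simp [liftGen, genH]

@[simp]
theorem liftGen_genD (f : Module.Dual k V) : r.liftGen (genD f) = r.toD f := by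
  simp [liftGen, genD]

theorem liftGen_eq_of_rel ⦃x y : Gen k G V⦄ (h : Rel ρ δ x y) : r.liftGen x = r.liftGen y := by
  cases h with
  | one => simp
  | mul a b => simp
  | smash_left g v => simpa using r.smash_left g v
  | smash_right f g => simpa using r.smash_right f g
  | comm f v => simp [r.comm]

/-- The algebra map out of `Ã` given by a realization. -/
def liftTilde : ATilde ρ δ →ₐ[k] R :=
  RingQuot.liftAlgHom k ⟨r.liftGen, r.liftGen_eq_of_rel⟩

theorem liftTilde_mk (x : Gen k G V) :
    r.liftTilde (RingQuot.mkAlgHom k (Rel ρ δ) x) = r.liftGen x :=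
  RingQuot.liftAlgHom_mkAlgHom_apply k _ _ x

theorem liftTilde_comp_tildeV : r.liftTilde.comp (tildeV ρ δ) = TensorAlgebra.lift k r.toV :=
  TensorAlgebra.hom_ext <| LinearMap.ext fun v => by simp [tildeV, liftTilde_mk]

theorem liftTilde_comp_tildeD : r.liftTilde.comp (tildeD ρ δ) = TensorAlgebra.lift k r.toD :=
  TensorAlgebra.hom_ext <| LinearMap.ext fun f => by simp [tildeD, liftTilde_mk]

section Lift

variable (hm : ∀ x ∈ Im, TensorAlgebra.lift k r.toV x = 0)
  (hp : ∀ y ∈ Ip, TensorAlgebra.lift k r.toD y = 0)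

include hm hp in
theorem liftTilde_eq_of_qrel ⦃x y : ATilde ρ δ⦄ (h : QRel ρ δ Im Ip x y) :
    r.liftTilde x = r.liftTilde y := by
  cases h with
  | minus x hx => simpa using (AlgHom.congr_fun r.liftTilde_comp_tildeV x).trans (hm x hx)
  | plus y hy => simpa using (AlgHom.congr_fun r.liftTilde_comp_tildeD y).trans (hp y hy)

/-- The algebra map out of `Ã/⟨I⁻, I⁺⟩` given by a realization. -/
def lift : AQuot ρ δ Im Ip →ₐ[k] R :=
  RingQuot.liftAlgHom k ⟨r.liftTilde, r.liftTilde_eq_of_qrel hm hp⟩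

theorem lift_mkQuot (x : Gen k G V) : r.lift hm hp (mkQuot ρ δ Im Ip x) = r.liftGen x :=
  (RingQuot.liftAlgHom_mkAlgHom_apply k _ _ _).trans (r.liftTilde_mk x)

theorem lift_toV (v : V) : r.lift hm hp ((quotRealization ρ δ Im Ip).toV v) = r.toV v :=
  (r.lift_mkQuot hm hp _).trans (r.liftGen_genV v)

theorem lift_toH (a : MonoidAlgebra k G) :
    r.lift hm hp ((quotRealization ρ δ Im Ip).toH a) = r.toH a :=
  (r.lift_mkQuot hm hp _).trans (r.liftGen_genH a)

theorem lift_toD (f : Module.Dual k V) :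
    r.lift hm hp ((quotRealization ρ δ Im Ip).toD f) = r.toD f :=
  (r.lift_mkQuot hm hp _).trans (r.liftGen_genD f)

end Lift

end Realization

end Quotient

/-! ### Triangular decomposition -/

section OrderedProduct

variable {k G V R : Type*} [Field k] [Group G] [AddCommGroup V] [Module k V] [Ring R] [Algebra k R]
  {ρ : Representation k G V} {δ : V →ₗ[k] MonoidAlgebra k G ⊗[k] V}

namespace Realization

variable (r : Realization ρ δ R) (hV : ∀ v v', Commute (r.toV v) (r.toV v'))
  (hD : ∀ f f', Commute (r.toD f) (r.toD f'))

/-- The map `b ⊗ h ⊗ φ ↦ b h φ`. -/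
def orderedProduct :
    SymmetricAlgebra k V ⊗[k] (MonoidAlgebra k G ⊗[k] SymmetricAlgebra k (Module.Dual k V)) →ₗ[k]
      R :=
  LinearMap.mul' k R ∘ₗ TensorProduct.map (symmetricLift r.toV hV).toLinearMap
    (LinearMap.mul' k R ∘ₗ
      TensorProduct.map r.toH.toLinearMap (symmetricLift r.toD hD).toLinearMap)

@[simp]
theorem orderedProduct_tmul (x : SymmetricAlgebra k V) (a : MonoidAlgebra k G)
    (φ : SymmetricAlgebra k (Module.Dual k V)) :
    r.orderedProduct hV hD (x ⊗ₜ (a ⊗ₜ φ)) =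
      symmetricLift r.toV hV x * (r.toH a * symmetricLift r.toD hD φ) :=
  rfl

theorem orderedProduct_generatorMul (v : V) (z) :
    r.orderedProduct hV hD (generatorMul _ v z) = r.toV v * r.orderedProduct hV hD z := by
  have : r.orderedProduct hV hD ∘ₗ generatorMul _ v =
      LinearMap.mulLeft k (r.toV v) ∘ₗ r.orderedProduct hV hD :=
    TensorProduct.ext <| LinearMap.ext fun x => TensorProduct.ext' fun a φ => by
      simp [mul_assoc]
  exact LinearMap.congr_fun this z

end Realization

end OrderedProduct

section GroupAlgebraTensor

variable {k G P X : Type*} [CommSemiring k] [Monoid G] [AddCommMonoid P] [Module k P]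
  [AddCommMonoid X] [Module k X]

theorem groupAlgebra_tensor_ext {φ ψ : MonoidAlgebra k G ⊗[k] P →ₗ[k] X}
    (h : ∀ g p, φ (MonoidAlgebra.of k G g ⊗ₜ p) = ψ (MonoidAlgebra.of k G g ⊗ₜ p)) : φ = ψ :=
  TensorProduct.ext <| groupAlgebra_hom_ext fun g => LinearMap.ext fun p => h g p

variable (k G P) in
/-- The action of `G` on `kG ⊗ P` by left multiplication on the first factor. -/
def leftMulRep : Representation k G (MonoidAlgebra k G ⊗[k] P) :=
  (MonoidAlgebra.lift k _ G).symm ((Module.End.rTensorAlgHom k _ P).comp (Algebra.lmul k _))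

@[simp]
theorem leftMulRep_tmul (g : G) (a : MonoidAlgebra k G) (p : P) :
    leftMulRep k G P g (a ⊗ₜ p) = (MonoidAlgebra.of k G g * a) ⊗ₜ p :=
  rfl

theorem asAlgebraHom_leftMulRep_tmul (a b : MonoidAlgebra k G) (p : P) :
    (leftMulRep k G P).asAlgebraHom a (b ⊗ₜ p) = (a * b) ⊗ₜ p :=
  LinearMap.congr_fun (AlgHom.congr_fun ((MonoidAlgebra.lift k _ G).apply_symm_apply _) a) (b ⊗ₜ p)

variable {V : Type*} [AddCommMonoid V] [Module k V] (ρ : Representation k G V)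

/-- The action `f ⬝ (h ⊗ φ) = h ⊗ (f ∘ h) φ` of `V*` on `kG ⊗ S(V*)`, dictated by the relation
`f h = h (f ∘ h)`. -/
def dualMul : Module.Dual k V →ₗ[k]
    Module.End k (MonoidAlgebra k G ⊗[k] SymmetricAlgebra k (Module.Dual k V)) where
  toFun f := TensorProduct.lift <| (MonoidAlgebra.basis G k).constr k fun h =>
    TensorProduct.mk k _ _ (MonoidAlgebra.of k G h) ∘ₗ
      LinearMap.mulLeft k (SymmetricAlgebra.ι k _ ((ρ h).dualMap f))
  map_add' f f' := groupAlgebra_tensor_ext fun h φ => by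
    simp [← MonoidAlgebra.basis_apply, add_mul, TensorProduct.tmul_add]
  map_smul' r f := groupAlgebra_tensor_ext fun h φ => by
    simp [← MonoidAlgebra.basis_apply]

@[simp]
theorem dualMul_of_tmul (f : Module.Dual k V) (h : G)
    (φ : SymmetricAlgebra k (Module.Dual k V)) :
    dualMul ρ f (MonoidAlgebra.of k G h ⊗ₜ φ) =
      MonoidAlgebra.of k G h ⊗ₜ (SymmetricAlgebra.ι k _ ((ρ h).dualMap f) * φ) := by
  simp [dualMul, ← MonoidAlgebra.basis_apply]

theorem dualMul_commute (f f' : Module.Dual k V) : Commute (dualMul ρ f) (dualMul ρ f') :=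
  groupAlgebra_tensor_ext fun h φ => by
    simp only [Module.End.mul_apply, dualMul_of_tmul, mul_left_comm]

theorem dualMul_mul_leftMulRep (f : Module.Dual k V) (g : G) :
    dualMul ρ f * leftMulRep k G _ g = leftMulRep k G _ g * dualMul ρ ((ρ g).dualMap f) :=
  groupAlgebra_tensor_ext fun h φ => by
    have : (ρ (g * h)).dualMap f = (ρ h).dualMap ((ρ g).dualMap f) := by rw [map_mul]; rfl
    simp only [Module.End.mul_apply, dualMul_of_tmul, leftMulRep_tmul, ← map_mul, this]

end GroupAlgebraTensor

section Fock

variable {k G V : Type*} [Field k] [Group G] [AddCommGroup V] [Module k V]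
  {ρ : Representation k G V} {δ : V →ₗ[k] MonoidAlgebra k G ⊗[k] V}
  (hV : ∀ f, HasSymmetricCommutators ρ (pairing δ f))

variable (k G V) in
/-- The space `S(V) ⊗ kG ⊗ S(V*)` on which the braided double is going to act. -/
abbrev FockSpace :=
  SymmetricAlgebra k V ⊗[k] (MonoidAlgebra k G ⊗[k] SymmetricAlgebra k (Module.Dual k V))

/-- The realization of `V`, `G` and `V*` on `S(V) ⊗ kG ⊗ S(V*)` by multiplication, the diagonal
action and Dunkl operators. -/
def fockRealization (hδ : IsYetterDrinfeld ρ δ) :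
    Realization ρ δ (Module.End k (FockSpace k G V)) where
  toV := generatorMul _
  toH := (inducedRep ρ (leftMulRep k G _)).asAlgebraHom
  toD := dunkl (leftMulRep k G _) hV (dualMul ρ)
  smash_left g v := LinearMap.ext fun z => by simp
  smash_right f g := by
    simpa using dunkl_mul_inducedRep hV hδ (dualMul_mul_leftMulRep ρ) f g
  comm f v := LinearMap.ext fun z => dunkl_generatorMul _ hV _ f v z

theorem fockRealization_toV_commute (hδ : IsYetterDrinfeld ρ δ) (v v' : V) :
    Commute ((fockRealization hV hδ).toV v) ((fockRealization hV hδ).toV v') :=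
  generatorMul_commute v v'

theorem fockRealization_toD_commute (hδ : IsYetterDrinfeld ρ δ)
    (hD : ∀ v, HasSymmetricCommutators (fun h => (ρ h).dualMap) (pairing δ · v))
    (f f' : Module.Dual k V) :
    Commute ((fockRealization hV hδ).toD f) ((fockRealization hV hδ).toD f') :=
  dunkl_commute hV hδ (dualMul_mul_leftMulRep ρ) hD (dualMul_commute ρ) f f'

end Fock

section PBW

variable {k G V : Type*} [Field k] [Group G] [AddCommGroup V] [Module k V]
  {ρ : Representation k G V} {δ : V →ₗ[k] MonoidAlgebra k G ⊗[k] V}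

section Intertwining

variable {R : Type*} [Ring R] [Algebra k R] (r : Realization ρ δ R)
  (hrV : ∀ v v', Commute (r.toV v) (r.toV v')) (hrD : ∀ f f', Commute (r.toD f) (r.toD f'))
  (hV : ∀ f, HasSymmetricCommutators ρ (pairing δ f))

theorem orderedProduct_inducedRep (a : MonoidAlgebra k G) (z) :
    r.orderedProduct hrV hrD ((inducedRep ρ (leftMulRep k G _)).asAlgebraHom a z) =
      r.toH a * r.orderedProduct hrV hrD z := by
  suffices h : ∀ g, r.orderedProduct hrV hrD ∘ₗ inducedRep ρ (leftMulRep k G _) g =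
      LinearMap.mulLeft k (r.toH (MonoidAlgebra.of k G g)) ∘ₗ r.orderedProduct hrV hrD by
    have : r.orderedProduct hrV hrD ∘ₗ LinearMap.applyₗ z ∘ₗ
        (inducedRep ρ (leftMulRep k G _)).asAlgebraHom.toLinearMap =
        LinearMap.mulRight k (r.orderedProduct hrV hrD z) ∘ₗ r.toH.toLinearMap :=
      groupAlgebra_hom_ext fun g => by
        simp only [LinearMap.comp_apply, AlgHom.toLinearMap_apply, LinearMap.applyₗ_apply_apply,
          LinearMap.mulRight_apply, Representation.asAlgebraHom_of]
        exact LinearMap.congr_fun (h g) z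
    exact LinearMap.congr_fun this a
  refine fun g => symmetricAlgebra_tensor_ext (fun n => ?_) fun v z hz => ?_
  · induction n using TensorProduct.induction_on with
    | zero => simp only [TensorProduct.tmul_zero, map_zero]
    | tmul a φ =>
      simp only [LinearMap.comp_apply, LinearMap.mulLeft_apply, inducedRep_one_tmul,
        leftMulRep_tmul, Realization.orderedProduct_tmul, map_one, one_mul, map_mul, mul_assoc]
    | add n n' hn hn' => simp only [TensorProduct.tmul_add, map_add, hn, hn']
  · simp only [LinearMap.comp_apply, LinearMap.mulLeft_apply, inducedRep_generatorMul,
      Realization.orderedProduct_generatorMul] at hz ⊢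
    rw [hz, ← mul_assoc, ← mul_assoc, r.smash_left]

theorem orderedProduct_dunkl (f : Module.Dual k V) (z) :
    r.orderedProduct hrV hrD (dunkl (leftMulRep k G _) hV (dualMul ρ) f z) =
      r.toD f * r.orderedProduct hrV hrD z := by
  suffices h : r.orderedProduct hrV hrD ∘ₗ dunkl (leftMulRep k G _) hV (dualMul ρ) f =
      LinearMap.mulLeft k (r.toD f) ∘ₗ r.orderedProduct hrV hrD from LinearMap.congr_fun h z
  refine symmetricAlgebra_tensor_ext (fun n => ?_) fun v z hz => ?_
  · have : r.orderedProduct hrV hrD ∘ₗ TensorProduct.mk k _ _ 1 ∘ₗ dualMul ρ f =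
        LinearMap.mulLeft k (r.toD f) ∘ₗ r.orderedProduct hrV hrD ∘ₗ TensorProduct.mk k _ _ 1 :=
      groupAlgebra_tensor_ext fun h φ => by
        simp only [LinearMap.comp_apply, TensorProduct.mk_apply, dualMul_of_tmul,
          LinearMap.mulLeft_apply, Realization.orderedProduct_tmul, map_one, one_mul, map_mul,
          symmetricLift_ι, ← mul_assoc, r.smash_right]
    simpa using LinearMap.congr_fun this n
  · simp only [LinearMap.comp_apply, LinearMap.mulLeft_apply, dunkl_generatorMul, map_add,
      Realization.orderedProduct_generatorMul, pairingAction_apply,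
      orderedProduct_inducedRep] at hz ⊢
    rw [hz, ← mul_assoc, ← mul_assoc, ← add_mul, r.comm]

end Intertwining

section SymmetricIdeals

/-- The quotient of `Ã` in which the elements of `V` commute and the elements of `V*` commute. -/
abbrev SymmetricDouble (ρ : Representation k G V) (δ : V →ₗ[k] MonoidAlgebra k G ⊗[k] V) :=
  AQuot ρ δ (RingHom.ker (SymmetricAlgebra.algHom k V))
    (RingHom.ker (SymmetricAlgebra.algHom k (Module.Dual k V)))

variable (ρ δ) in
/-- The tautological realization in `SymmetricDouble ρ δ`. -/
abbrev symmetricRealization : Realization ρ δ (SymmetricDouble ρ δ) :=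
  quotRealization ρ δ _ _

variable (ρ δ) in
theorem symmetricRealization_toV_commute (v v' : V) :
    Commute ((symmetricRealization ρ δ).toV v) ((symmetricRealization ρ δ).toV v') := by
  rw [← quotV_ι, ← quotV_ι, Commute, SemiconjBy, ← map_mul,
    mul_comm_quotient_of_eq_ker_algHom rfl, map_mul]

variable (ρ δ) in
theorem symmetricRealization_toD_commute (f f' : Module.Dual k V) :
    Commute ((symmetricRealization ρ δ).toD f) ((symmetricRealization ρ δ).toD f') := by
  rw [← quotD_ι, ← quotD_ι, Commute, SemiconjBy, ← map_mul,
    mul_comm_quotient_of_eq_ker_algHom rfl, map_mul]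

variable (ρ δ) in
/-- The map `S(V) ⊗ kG ⊗ S(V*) → SymmetricDouble ρ δ`, `b ⊗ h ⊗ φ ↦ b h φ`. -/
abbrev symmetricMul : FockSpace k G V →ₗ[k] SymmetricDouble ρ δ :=
  (symmetricRealization ρ δ).orderedProduct (symmetricRealization_toV_commute ρ δ)
    (symmetricRealization_toD_commute ρ δ)

theorem bijective_mulMap_iff_symmetricMul :
    Function.Bijective (mulMap ρ δ (RingHom.ker (SymmetricAlgebra.algHom k V))
      (RingHom.ker (SymmetricAlgebra.algHom k (Module.Dual k V)))) ↔
      Function.Bijective (symmetricMul ρ δ) := by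
  let e := TensorProduct.congr
    (Ideal.quotientKerAlgEquivOfSurjective (SymmetricAlgebra.algHom_surjective k V)).toLinearEquiv
    ((Ideal.quotientKerAlgEquivOfSurjective
      (SymmetricAlgebra.algHom_surjective k (Module.Dual k V))).toLinearEquiv.lTensor
        (MonoidAlgebra k G))
  have : mulMap ρ δ _ _ = symmetricMul ρ δ ∘ₗ e.toLinearMap := by
    refine TensorProduct.ext (LinearMap.ext fun x => TensorProduct.ext' fun a y => ?_)
    obtain ⟨x, rfl⟩ := Ideal.Quotient.mk_surjective x
    obtain ⟨y, rfl⟩ := Ideal.Quotient.mk_surjective y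
    exact congrArg₂ (fun b φ => b * ((symmetricRealization ρ δ).toH a * φ))
      (quotV_mk ..) (quotD_mk ..)
  rw [this, LinearMap.coe_comp]
  exact e.bijective.of_comp_iff _

variable (hδ : IsYetterDrinfeld ρ δ) (hV : ∀ f, HasSymmetricCommutators ρ (pairing δ f))
  (hD : ∀ v, HasSymmetricCommutators (fun h => (ρ h).dualMap) (pairing δ · v))

/-- The representation of `SymmetricDouble ρ δ` on `S(V) ⊗ kG ⊗ S(V*)`. -/
def fockAction : SymmetricDouble ρ δ →ₐ[k] Module.End k (FockSpace k G V) :=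
  (fockRealization hV hδ).lift
    (fun _ => lift_eq_zero_of_mem_ker_algHom _ (fockRealization_toV_commute hV hδ))
    (fun _ => lift_eq_zero_of_mem_ker_algHom _ (fockRealization_toD_commute hV hδ hD))

theorem fockAction_toV (v : V) :
    fockAction hδ hV hD ((symmetricRealization ρ δ).toV v) = generatorMul _ v :=
  Realization.lift_toV ..

theorem fockAction_toH (a : MonoidAlgebra k G) :
    fockAction hδ hV hD ((symmetricRealization ρ δ).toH a) =
      (inducedRep ρ (leftMulRep k G _)).asAlgebraHom a :=
  Realization.lift_toH ..

theorem fockAction_toD (f : Module.Dual k V) :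
    fockAction hδ hV hD ((symmetricRealization ρ δ).toD f) =
      dunkl (leftMulRep k G _) hV (dualMul ρ) f :=
  Realization.lift_toD ..

theorem symmetricMul_fockAction (x : SymmetricDouble ρ δ) (z) :
    symmetricMul ρ δ (fockAction hδ hV hD x z) = x * symmetricMul ρ δ z := by
  induction x using quotRealization_induction generalizing z with
  | toV v => rw [fockAction_toV, Realization.orderedProduct_generatorMul]
  | toH a => rw [fockAction_toH, orderedProduct_inducedRep]
  | toD f => rw [fockAction_toD, orderedProduct_dunkl]
  | mul x y hx hy => rw [map_mul, Module.End.mul_apply, hx, hy, mul_assoc]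
  | add x y hx hy => rw [map_add, LinearMap.add_apply, map_add, hx, hy, add_mul]

theorem fockAction_symmetricLift_toD (φ : SymmetricAlgebra k (Module.Dual k V)) :
    fockAction hδ hV hD (symmetricLift (symmetricRealization ρ δ).toD
      (symmetricRealization_toD_commute ρ δ) φ) (1 ⊗ₜ (1 ⊗ₜ 1)) = 1 ⊗ₜ (1 ⊗ₜ φ) := by
  suffices LinearMap.applyₗ (1 ⊗ₜ (1 ⊗ₜ 1)) ∘ₗ (fockAction hδ hV hD).toLinearMap ∘ₗ
      (symmetricLift (symmetricRealization ρ δ).toD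
        (symmetricRealization_toD_commute ρ δ)).toLinearMap =
      TensorProduct.mk k _ _ 1 ∘ₗ TensorProduct.mk k _ _ 1 from LinearMap.congr_fun this φ
  refine symmetricAlgebra_linearMap_ext (by simp) fun f φ hφ => ?_
  simp only [LinearMap.comp_apply, AlgHom.toLinearMap_apply, LinearMap.applyₗ_apply_apply,
    TensorProduct.mk_apply] at hφ ⊢
  rw [map_mul, map_mul, Module.End.mul_apply, hφ, symmetricLift_ι, fockAction_toD,
    dunkl_one_tmul]
  refine congrArg (1 ⊗ₜ[k] ·) ?_
  simpa only [map_one, Module.End.one_eq_id, LinearMap.dualMap_id, LinearMap.id_apply]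
    using dualMul_of_tmul ρ f 1 φ

theorem fockAction_symmetricMul (z) :
    fockAction hδ hV hD (symmetricMul ρ δ z) (1 ⊗ₜ (1 ⊗ₜ 1)) = z := by
  suffices LinearMap.applyₗ (1 ⊗ₜ (1 ⊗ₜ 1)) ∘ₗ (fockAction hδ hV hD).toLinearMap ∘ₗ
      symmetricMul ρ δ = LinearMap.id from LinearMap.congr_fun this z
  refine symmetricAlgebra_tensor_ext (fun n => ?_) fun v z hz => ?_
  · induction n using TensorProduct.induction_on with
    | zero => simp
    | tmul a φ =>
      simp only [LinearMap.comp_apply, AlgHom.toLinearMap_apply, LinearMap.applyₗ_apply_apply,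
        Realization.orderedProduct_tmul, map_one, one_mul, map_mul, Module.End.mul_apply,
        fockAction_symmetricLift_toD, fockAction_toH, LinearMap.id_apply]
      rw [asAlgebraHom_inducedRep_one_tmul, asAlgebraHom_leftMulRep_tmul, mul_one]
    | add n n' hn hn' => simp only [TensorProduct.tmul_add, map_add, hn, hn']
  · simp only [LinearMap.comp_apply, AlgHom.toLinearMap_apply, LinearMap.applyₗ_apply_apply,
      LinearMap.id_apply, Realization.orderedProduct_generatorMul, map_mul, Module.End.mul_apply,
      fockAction_toV] at hz ⊢
    rw [hz]

include hδ hV hD in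
theorem bijective_symmetricMul : Function.Bijective (symmetricMul ρ δ) :=
  Function.bijective_iff_has_inverse.2
    ⟨fun x => fockAction hδ hV hD x (1 ⊗ₜ (1 ⊗ₜ 1)), fockAction_symmetricMul hδ hV hD,
      fun x => by simp [symmetricMul_fockAction]⟩

/-- The braided double `S(V) ⋊ kG ⋉ S(V*)` attached to a quasicoaction with symmetric
commutators. -/
def BraidedDouble.ofHasSymmetricCommutators : BraidedDouble ρ δ where
  yetterDrinfeld := hδ
  Iminus := RingHom.ker (SymmetricAlgebra.algHom k V)
  Iplus := RingHom.ker (SymmetricAlgebra.algHom k (Module.Dual k V))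
  twoSided_minus := inferInstance
  twoSided_plus := inferInstance
  Iminus_le := ker_symmetricAlgebra_algHom_le k V
  Iplus_le := ker_symmetricAlgebra_algHom_le k (Module.Dual k V)
  triangular := bijective_mulMap_iff_symmetricMul.2 (bijective_symmetricMul hδ hV hD)

end SymmetricIdeals

end PBW

/-! ### Necessity of symmetric commutators -/

section Necessity

variable {k G V R Y : Type*} [Field k] [Group G] [AddCommGroup V] [Module k V] [Ring R]
  [Algebra k R] [AddCommGroup Y] [Module k Y] {ρ : Representation k G V}
  {δ : V →ₗ[k] MonoidAlgebra k G ⊗[k] V}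

theorem eq_zero_of_pairing_eq_zero (h : ∀ f v, pairing δ f v = 0) : δ = 0 :=
  component_ext fun g => LinearMap.ext fun v => by
    refine (Module.forall_dual_apply_eq_zero_iff k _).1 fun f => ?_
    rw [← coeff_pairing, h, MonoidAlgebra.coeff_zero, Finsupp.zero_apply]

namespace Realization

attribute [local instance] LieRing.ofAssociativeRing

variable (r : Realization ρ δ R)

theorem lie_toD_toV (f : Module.Dual k V) (v : V) :
    ⁅r.toD f, r.toV v⁆ = r.toH (pairing δ f v) := by
  rw [Ring.lie_def, r.comm, add_sub_cancel_left]

-- Jacobi identity for `f`, `v`, `v'`, where `[v, v'] = 0`.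
theorem hasSymmetricCommutators_toV (hV : ∀ v v', Commute (r.toV v) (r.toV v'))
    {ι : V →ₗ[k] Y} (hι : Function.Injective ι) (π : G → R →ₗ[k] Y)
    (hπ : ∀ h v a, π h (r.toV v * r.toH a) = a.coeff h • ι v) (f : Module.Dual k V) :
    HasSymmetricCommutators ρ (pairing δ f) := by
  refine hasSymmetricCommutators_of_sub_comm
    (L := ((LinearMap.mul k R).flip ∘ₗ r.toV).compl₂ r.toH.toLinearMap)
    (R := (LinearMap.mul k R ∘ₗ r.toV).compl₂ r.toH.toLinearMap)
    (fun g v => r.smash_left g v) (fun v v' => ?_) hι π hπ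
  calc ⁅r.toH (pairing δ f v), r.toV v'⁆ = ⁅⁅r.toD f, r.toV v⁆, r.toV v'⁆ := by rw [lie_toD_toV]
    _ = ⁅⁅r.toD f, r.toV v'⁆, r.toV v⁆ := by
      rw [lie_lie, (hV v v').lie_eq, lie_zero, zero_sub, lie_skew]
    _ = ⁅r.toH (pairing δ f v'), r.toV v⁆ := by rw [lie_toD_toV]

-- Jacobi identity for `f`, `f'`, `v`, where `[f, f'] = 0`.
theorem hasSymmetricCommutators_toD (hD : ∀ f f', Commute (r.toD f) (r.toD f'))
    {ι : Module.Dual k V →ₗ[k] Y} (hι : Function.Injective ι) (π : G → R →ₗ[k] Y)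
    (hπ : ∀ h f a, π h (r.toH a * r.toD f) = a.coeff h • ι f) (v : V) :
    HasSymmetricCommutators (fun h => (ρ h).dualMap) (pairing δ · v) := by
  refine hasSymmetricCommutators_of_sub_comm
    (L := (LinearMap.mul k R ∘ₗ r.toD).compl₂ r.toH.toLinearMap)
    (R := ((LinearMap.mul k R).flip ∘ₗ r.toD).compl₂ r.toH.toLinearMap)
    (fun g f => r.smash_right f g) (fun f f' => ?_) hι π hπ
  calc ⁅r.toD f', r.toH (pairing δ f v)⁆ = ⁅r.toD f', ⁅r.toD f, r.toV v⁆⁆ := by rw [lie_toD_toV]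
    _ = ⁅r.toD f, ⁅r.toD f', r.toV v⁆⁆ := by
      rw [leibniz_lie, (hD f' f).lie_eq, zero_lie, zero_add]
    _ = ⁅r.toD f, r.toH (pairing δ f' v)⁆ := by rw [lie_toD_toV]

theorem isUnit_toH_of (g : G) : IsUnit (r.toH (MonoidAlgebra.of k G g)) :=
  (Group.isUnit g).map ((r.toH : MonoidAlgebra k G →* R).comp (MonoidAlgebra.of k G))

theorem toV_apply_eq_zero (g : G) {v : V} (hv : r.toV v = 0) : r.toV (ρ g v) = 0 :=
  (r.isUnit_toH_of g).mul_left_eq_zero.1 <| by rw [← r.smash_left, hv, mul_zero]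

theorem toD_dualMap_eq_zero (g : G) {f : Module.Dual k V} (hf : r.toD f = 0) :
    r.toD ((ρ g).dualMap f) = 0 :=
  (r.isUnit_toH_of g).mul_right_eq_zero.1 <| by rw [← r.smash_right, hf, zero_mul]

variable {r}

theorem toV_injective (hρ : ρ.IsIrreducible) (hH : Function.Injective r.toH) (hδ : δ ≠ 0) :
    Function.Injective r.toV := by
  let K : Subrepresentation ρ := ⟨LinearMap.ker r.toV, fun g _ hv => r.toV_apply_eq_zero g hv⟩
  rcases hρ.eq_bot_or_eq_top K with hK | hK
  · exact LinearMap.ker_eq_bot.1 (congrArg Subrepresentation.toSubmodule hK)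
  · have htop : LinearMap.ker r.toV = ⊤ := congrArg Subrepresentation.toSubmodule hK
    refine absurd (eq_zero_of_pairing_eq_zero fun f v => hH ?_) hδ
    rw [← lie_toD_toV, LinearMap.ker_eq_top.1 htop, LinearMap.zero_apply, lie_zero, map_zero]

theorem toD_injective (hρ : ρ.IsIrreducible) (hH : Function.Injective r.toH) (hδ : δ ≠ 0) :
    Function.Injective r.toD := by
  let K : Subrepresentation ρ := ⟨(LinearMap.ker r.toD).dualCoannihilator, fun g v hv => by
    rw [Submodule.mem_dualCoannihilator] at hv ⊢
    exact fun f hf => hv _ (r.toD_dualMap_eq_zero g hf)⟩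
  rcases hρ.eq_bot_or_eq_top K with hK | hK
  · have hbot : (LinearMap.ker r.toD).dualCoannihilator = ⊥ :=
      congrArg Subrepresentation.toSubmodule hK
    refine absurd (component_ext fun g => LinearMap.ext fun v => ?_) hδ
    refine (Submodule.mem_bot k).1 (hbot.le ((Submodule.mem_dualCoannihilator _).2 fun f hf => ?_))
    have : pairing δ f v = 0 := hH <| by
      rw [← lie_toD_toV, LinearMap.mem_ker.1 hf, zero_lie, map_zero]
    rw [← coeff_pairing, this, MonoidAlgebra.coeff_zero, Finsupp.zero_apply]
  · have htop : (LinearMap.ker r.toD).dualCoannihilator = ⊤ :=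
      congrArg Subrepresentation.toSubmodule hK
    refine LinearMap.ker_eq_bot.1 (le_bot_iff.1 fun f hf => ?_)
    exact LinearMap.ext fun v =>
      (Submodule.mem_dualCoannihilator v).1 (htop.ge Submodule.mem_top) f hf

end Realization

/-- The counit of a quotient of `T(W)` by relations without constant term. -/
def counit {W : Type*} [AddCommGroup W] [Module k W] {I : Ideal (TensorAlgebra k W)}
    [I.IsTwoSided]
    (hI : I ≤ RingHom.ker (TensorAlgebra.algebraMapInv : TensorAlgebra k W →ₐ[k] k)) :
    (TensorAlgebra k W ⧸ I) →ₐ[k] k :=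
  Ideal.Quotient.liftₐ I TensorAlgebra.algebraMapInv fun _ hx => hI hx

namespace BraidedDouble

variable (B : BraidedDouble ρ δ)

/-- The tautological realization in a braided double. -/
abbrev realization : Realization ρ δ (AQuot ρ δ B.Iminus B.Iplus) :=
  quotRealization ρ δ B.Iminus B.Iplus

/-- The triangular decomposition `b ⊗ h ⊗ φ ↦ b h φ`. -/
def triangularEquiv :
    B.Uminus ⊗[k] (MonoidAlgebra k G ⊗[k] B.Uplus) ≃ₗ[k] AQuot ρ δ B.Iminus B.Iplus :=
  LinearEquiv.ofBijective _ B.triangular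

/-- The map `b a φ ↦ ε(φ) a_h b` of a braided double to `U⁻`. -/
def coeffMinus (h : G) : AQuot ρ δ B.Iminus B.Iplus →ₗ[k] B.Uminus :=
  (TensorProduct.rid k B.Uminus).toLinearMap ∘ₗ
    ((counit B.Iplus_le).toLinearMap ∘ₗ tensorCoeff h).lTensor B.Uminus ∘ₗ
      B.triangularEquiv.symm.toLinearMap

/-- The map `b a φ ↦ ε(b) a_h φ` of a braided double to `U⁺`. -/
def coeffPlus (h : G) : AQuot ρ δ B.Iminus B.Iplus →ₗ[k] B.Uplus :=
  (TensorProduct.lid k B.Uplus).toLinearMap ∘ₗ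
    TensorProduct.map (counit B.Iminus_le).toLinearMap (tensorCoeff h) ∘ₗ
      B.triangularEquiv.symm.toLinearMap

theorem coeffMinus_quotV_mul_toH (h : G) (x : B.Uminus) (a : MonoidAlgebra k G) :
    B.coeffMinus h (quotV ρ δ B.Iminus B.Iplus x * B.realization.toH a) = a.coeff h • x := by
  have : quotV ρ δ B.Iminus B.Iplus x * B.realization.toH a =
      B.triangularEquiv (x ⊗ₜ (a ⊗ₜ 1)) :=
    congrArg (_ * ·) ((mul_one _).symm.trans (congrArg (_ * ·) (map_one _).symm))
  simp [this, coeffMinus]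

theorem coeffPlus_toH_mul_quotD (h : G) (a : MonoidAlgebra k G) (y : B.Uplus) :
    B.coeffPlus h (B.realization.toH a * quotD ρ δ B.Iminus B.Iplus y) = a.coeff h • y := by
  have : B.realization.toH a * quotD ρ δ B.Iminus B.Iplus y =
      B.triangularEquiv (1 ⊗ₜ (a ⊗ₜ y)) :=
    (one_mul _).symm.trans (congrArg (· * _) (map_one _).symm)
  simp [this, coeffPlus]

theorem toH_injective : Function.Injective B.realization.toH := fun a a' h => by
  ext g
  have := congrArg (fun x => B.coeffMinus g (quotV ρ δ B.Iminus B.Iplus 1 * x)) h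
  simp only [coeffMinus_quotV_mul_toH] at this
  simpa using congrArg (counit B.Iminus_le) this

variable {B}

theorem hasSymmetricCommutators_minus (hρ : ρ.IsIrreducible)
    (hc : ∀ x y : B.Uminus, x * y = y * x) (f : Module.Dual k V) :
    HasSymmetricCommutators ρ (pairing δ f) := by
  rcases eq_or_ne δ 0 with rfl | hδ
  · intro h w w'
    simp [coeff_pairing, component]
  let ι : V →ₗ[k] B.Uminus := (Ideal.Quotient.mkₐ k B.Iminus).toLinearMap ∘ₗ TensorAlgebra.ι k
  have hι : ∀ v, quotV ρ δ B.Iminus B.Iplus (ι v) = B.realization.toV v := quotV_ι _ _ _ _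
  refine B.realization.hasSymmetricCommutators_toV (ι := ι) (fun v v' => ?_) ?_ B.coeffMinus
    (fun h v a => ?_) f
  · rw [← hι, ← hι, Commute, SemiconjBy, ← map_mul, hc, map_mul]
  · refine Function.Injective.of_comp (f := quotV ρ δ B.Iminus B.Iplus) ?_
    rw [show _ ∘ _ = _ from funext hι]
    exact Realization.toV_injective hρ B.toH_injective hδ
  · rw [← hι, coeffMinus_quotV_mul_toH]

theorem hasSymmetricCommutators_plus (hρ : ρ.IsIrreducible)
    (hc : ∀ x y : B.Uplus, x * y = y * x) (v : V) :
    HasSymmetricCommutators (fun h => (ρ h).dualMap) (pairing δ · v) := by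
  rcases eq_or_ne δ 0 with rfl | hδ
  · intro h w w'
    simp [coeff_pairing, component]
  let ι : Module.Dual k V →ₗ[k] B.Uplus :=
    (Ideal.Quotient.mkₐ k B.Iplus).toLinearMap ∘ₗ TensorAlgebra.ι k
  have hι : ∀ f, quotD ρ δ B.Iminus B.Iplus (ι f) = B.realization.toD f :=
    quotD_ι _ _ _ _
  refine B.realization.hasSymmetricCommutators_toD (ι := ι) (fun f f' => ?_) ?_ B.coeffPlus
    (fun h f a => ?_) v
  · rw [← hι, ← hι, Commute, SemiconjBy, ← map_mul, hc, map_mul]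
  · refine Function.Injective.of_comp (f := quotD ρ δ B.Iminus B.Iplus) ?_
    rw [show _ ∘ _ = _ from funext hι]
    exact Realization.toD_injective hρ B.toH_injective hδ
  · rw [← hι, coeffPlus_toH_mul_quotD]

end BraidedDouble

end Necessity

/-! ### The classification of quasicoactions with symmetric commutators -/

section RankOne

variable {k V W : Type*} [Field k] [AddCommGroup V] [Module k V] [AddCommGroup W] [Module k W]
  {T L : V →ₗ[k] W}

theorem smul_apply_comm_of_finrank_range_eq_one (hT : Module.finrank k (LinearMap.range T) = 1)
    (f : Module.Dual k W) (v w : V) : f (T v) • T w = f (T w) • T v := by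
  obtain ⟨x, -, hx⟩ := finrank_eq_one_iff'.1 hT
  obtain ⟨a, ha⟩ := hx (T.rangeRestrict v)
  obtain ⟨b, hb⟩ := hx (T.rangeRestrict w)
  have hv : T v = a • (x : W) := congrArg Subtype.val ha.symm
  have hw : T w = b • (x : W) := congrArg Subtype.val hb.symm
  simp only [hv, hw, map_smul, smul_smul, smul_eq_mul]
  ring_nf

theorem exists_eq_smul_of_apply_comm (hT : T ≠ 0)
    (hker : ∀ (f : Module.Dual k W) v w, f (L v) • T w = f (L w) • T v)
    (hrange : ∀ (f f' : Module.Dual k W) v w, f (L v) * f' (T w) = f' (L v) * f (T w)) :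
    ∃ a : k, L = a • T ∧ (a ≠ 0 → Module.finrank k (LinearMap.range T) = 1) := by
  obtain ⟨w, hw⟩ := DFunLike.ne_iff.1 hT
  obtain ⟨f, hf⟩ := Module.Projective.exists_dual_eq_one k hw
  have hL : ∀ v, L v = f (L w) • T v := fun v => by
    rw [hker, ← sub_eq_zero, ← Module.forall_dual_apply_eq_zero_iff k]
    intro f'
    rw [map_sub, map_smul, smul_eq_mul, hrange, hf, mul_one, sub_self]
  refine ⟨f (L w), LinearMap.ext hL, fun ha => ?_⟩
  refine finrank_eq_one_iff'.2 ⟨T.rangeRestrict w, fun h0 => hw (congrArg Subtype.val h0), ?_⟩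
  rintro ⟨_, v, rfl⟩
  refine ⟨(f (L w))⁻¹ * f (L v), Subtype.ext ?_⟩
  change _ • T w = T v
  rw [mul_smul, hker, inv_smul_smul₀ ha]

end RankOne

section Representations

variable {k G V : Type*} [Field k] [Group G] [AddCommGroup V] [Module k V]
  {ρ : Representation k G V} {δ : V →ₗ[k] MonoidAlgebra k G ⊗[k] V}

theorem hasSymmetricCommutators_pairing_iff :
    (∀ f, HasSymmetricCommutators ρ (pairing δ f)) ↔
      ∀ h (f : Module.Dual k V) v w,
        f (component δ h v) • (1 - ρ h) w = f (component δ h w) • (1 - ρ h) v := by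
  simp only [HasSymmetricCommutators, coeff_pairing]
  exact forall_comm

theorem hasSymmetricCommutators_dual_pairing_iff :
    (∀ v, HasSymmetricCommutators (fun h => (ρ h).dualMap) (pairing δ · v)) ↔
      ∀ h (f f' : Module.Dual k V) v w,
        f (component δ h v) * f' ((1 - ρ h) w) = f' (component δ h v) * f ((1 - ρ h) w) := by
  simp only [HasSymmetricCommutators, coeff_pairing, LinearMap.ext_iff]
  constructor
  · intro H h f f' v w
    simpa using H v h f f' w
  · intro H v h f f' w
    simpa using H h f f' v w

theorem hasSymmetricCommutators_iff_component (hρ : Function.Injective ρ) :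
    ((∀ f, HasSymmetricCommutators ρ (pairing δ f)) ∧
      ∀ v, HasSymmetricCommutators (fun h => (ρ h).dualMap) (pairing δ · v)) ↔
    ∀ h ≠ 1, ∃ a : k, component δ h = a • (1 - ρ h) ∧
      (a ≠ 0 → Module.finrank k (LinearMap.range (1 - ρ h)) = 1) := by
  rw [hasSymmetricCommutators_pairing_iff, hasSymmetricCommutators_dual_pairing_iff]
  refine ⟨fun ⟨hV, hD⟩ h h1 => exists_eq_smul_of_apply_comm ?_ (hV h) (hD h), fun H => ?_⟩
  · rw [Ne, sub_eq_zero, eq_comm, ← map_one ρ]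
    exact hρ.ne h1
  have key : ∀ h (f : Module.Dual k V) v w,
      f (component δ h v) • (1 - ρ h) w = f (component δ h w) • (1 - ρ h) v := by
    intro h f v w
    rcases eq_or_ne h 1 with rfl | h1
    · simp
    obtain ⟨a, ha, hrank⟩ := H h h1
    rcases eq_or_ne a 0 with rfl | ha0
    · simp [ha]
    · simp only [ha, LinearMap.smul_apply, map_smul, smul_assoc,
        smul_apply_comm_of_finrank_range_eq_one (hrank ha0) f v w]
  refine ⟨key, fun h f f' v w => ?_⟩
  rcases eq_or_ne h 1 with rfl | h1
  · simp
  obtain ⟨a, ha, hrank⟩ := H h h1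
  rcases eq_or_ne a 0 with rfl | ha0
  · simp [ha]
  have := congrArg (fun x => a * f' x) (smul_apply_comm_of_finrank_range_eq_one (hrank ha0) f v w)
  simp only [map_smul, smul_eq_mul] at this
  simp only [ha, LinearMap.smul_apply, map_smul, smul_eq_mul]
  linear_combination this

theorem one_sub_conj_mul (ρ : Representation k G V) (g h : G) :
    (1 - ρ (g * h * g⁻¹)) * ρ g = ρ g * (1 - ρ h) := by
  rw [sub_mul, ← map_mul, inv_mul_cancel_right, map_mul, mul_sub, one_mul, mul_one]

theorem IsYetterDrinfeld.commute_component_one (hδ : IsYetterDrinfeld ρ δ) (g : G) :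
    Commute (component δ 1) (ρ g) := by
  have := isYetterDrinfeld_iff.1 hδ g 1
  rw [mul_one, mul_inv_cancel] at this
  exact this.symm

theorem finrank_range_one_sub_conj (ρ : Representation k G V) (g h : G) :
    Module.finrank k (LinearMap.range (1 - ρ (g * h * g⁻¹))) =
      Module.finrank k (LinearMap.range (1 - ρ h)) := by
  let e : V ≃ₗ[k] V := LinearMap.GeneralLinearGroup.toLinearEquiv (ρ.asGroupHom g)
  have : (1 - ρ (g * h * g⁻¹)) ∘ₗ e.toLinearMap = e.toLinearMap ∘ₗ (1 - ρ h) :=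
    one_sub_conj_mul ρ g h
  rw [← LinearEquiv.range_comp e (1 - ρ (g * h * g⁻¹)), this, LinearMap.range_comp]
  exact LinearEquiv.finrank_map_eq e _

end Representations

section DeltaTC

variable {k V : Type*} [Field k] [AddCommGroup V] [Module k V]
  (G : Subgroup (LinearMap.GeneralLinearGroup k V))

theorem naturalRep_injective : Function.Injective (naturalRep G) := fun _ _ h =>
  Subtype.ext (Units.ext h)

variable {G}

theorem one_sub_naturalRep_ne_zero {s : G} (hs : s ∈ complexReflections G) :
    1 - naturalRep G s ≠ 0 := by
  intro h
  have : Module.finrank k (LinearMap.range (1 - naturalRep G s)) = 1 := hs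
  rw [h, LinearMap.range_zero, finrank_bot] at this
  exact zero_ne_one this

theorem ne_one_of_mem_complexReflections {s : G} (hs : s ∈ complexReflections G) : s ≠ 1 := by
  rintro rfl
  exact one_sub_naturalRep_ne_zero hs (by rw [map_one, sub_self])

theorem conj_mem_complexReflections_iff {g h : G} :
    g * h * g⁻¹ ∈ complexReflections G ↔ h ∈ complexReflections G :=
  (finrank_range_one_sub_conj (naturalRep G) g h).congr_left

variable (t : k) {c : complexReflections G →₀ k}

-- At `h = 1` the second summand vanishes because `1 - h` does.
theorem component_deltaTC (c : complexReflections G →₀ k) (h : G) :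
    component (deltaTC G t c) h =
      Finsupp.single 1 t h • 1 + c.mapDomain (↑) h • (1 - naturalRep G h) := by
  ext v
  have term : ∀ (s : complexReflections G) (a : k),
      a • (Finsupp.single (s : G) (1 : k) h • (v - naturalRep G s v)) =
        Finsupp.single (s : G) a h • (v - naturalRep G h v) := by
    intro s a
    rcases eq_or_ne h s with rfl | hs
    · simp
    · simp [Finsupp.single_eq_of_ne hs]
  have unit : t • (Finsupp.single (1 : G) (1 : k) h • v) = Finsupp.single (1 : G) t h • v := by
    rw [smul_smul, ← smul_eq_mul, ← Finsupp.smul_apply, Finsupp.smul_single_one]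
  simp [component, deltaTC, Finsupp.sum, Finsupp.mapDomain, Finsupp.finsetSum_apply,
    Finset.sum_smul, MonoidAlgebra.one_def, term, unit]

theorem mapDomain_conj (hc : IsConjInvariant G c) (g h : G) :
    c.mapDomain (↑) (g * h * g⁻¹) = c.mapDomain ((↑) : complexReflections G → G) h := by
  by_cases hh : h ∈ complexReflections G
  · have hg := conj_mem_complexReflections_iff (g := g).2 hh
    exact (Finsupp.mapDomain_apply Subtype.val_injective c ⟨_, hg⟩).trans <|
      (hc g ⟨h, hh⟩ ⟨_, hg⟩ rfl).trans
        (Finsupp.mapDomain_apply Subtype.val_injective c ⟨h, hh⟩).symm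
  · rw [Finsupp.mapDomain_of_notMem_range, Finsupp.mapDomain_of_notMem_range]
    · simpa using hh
    · simpa [conj_mem_complexReflections_iff] using hh

theorem isYetterDrinfeld_deltaTC (hc : IsConjInvariant G c) :
    IsYetterDrinfeld (naturalRep G) (deltaTC G t c) := by
  refine isYetterDrinfeld_iff.2 fun g h => ?_
  have hone : Finsupp.single 1 t (g * h * g⁻¹) = Finsupp.single 1 t h := by
    classical simp only [Finsupp.single_apply, eq_comm (a := (1 : G)), conj_eq_one_iff]
  rw [component_deltaTC, component_deltaTC, hone, mapDomain_conj hc, mul_add, add_mul,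
    mul_smul_comm, mul_smul_comm, smul_mul_assoc, smul_mul_assoc, one_sub_conj_mul, mul_one,
    one_mul]

theorem hasSymmetricCommutators_deltaTC (c : complexReflections G →₀ k) :
    (∀ f, HasSymmetricCommutators (naturalRep G) (pairing (deltaTC G t c) f)) ∧
      ∀ v, HasSymmetricCommutators (fun h => (naturalRep G h).dualMap)
        (pairing (deltaTC G t c) · v) := by
  refine (hasSymmetricCommutators_iff_component (naturalRep_injective G)).2 fun h h1 => ?_
  refine ⟨c.mapDomain (↑) h, ?_, fun hne => ?_⟩
  · rw [component_deltaTC, Finsupp.single_eq_of_ne h1, zero_smul, zero_add]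
  · by_contra hh
    change h ∉ complexReflections G at hh
    exact hne (Finsupp.mapDomain_of_notMem_range _ _ (by simpa using hh))

variable {δ : V →ₗ[k] MonoidAlgebra k G ⊗[k] V}

theorem IsYetterDrinfeld.isConjInvariant (hδ : IsYetterDrinfeld (naturalRep G) δ)
    (hc : ∀ s : complexReflections G, component δ (s : G) = c s • (1 - naturalRep G s)) :
    IsConjInvariant G c := by
  intro g s s' hs
  have h := isYetterDrinfeld_iff.1 hδ g s
  have hconj := one_sub_conj_mul (naturalRep G) g s
  rw [← hs] at h hconj
  rw [hc, hc, mul_smul_comm, smul_mul_assoc, ← hconj] at h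
  refine (smul_left_injective k ?_ h).symm
  exact mt ((Group.isUnit g).map (naturalRep G)).mul_left_eq_zero.1
    (one_sub_naturalRep_ne_zero s'.2)

theorem exists_eq_deltaTC_of_component_eq (hδ : IsYetterDrinfeld (naturalRep G) δ) {t : k}
    {a : G → k}
    (ha : ∀ h, component δ h = Finsupp.single 1 t h • 1 + a h • (1 - naturalRep G h))
    (hfin : (Function.support a).Finite) (hmem : Function.support a ⊆ complexReflections G) :
    ∃ c : complexReflections G →₀ k, IsConjInvariant G c ∧ δ = deltaTC G t c := by
  let c := (Finsupp.ofSupportFinite a hfin).comapDomain ((↑) : complexReflections G → G)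
    Subtype.val_injective.injOn
  have hc : c.mapDomain (↑) = Finsupp.ofSupportFinite a hfin :=
    Finsupp.mapDomain_comapDomain _ Subtype.val_injective _ fun h h0 =>
      ⟨⟨h, hmem (Finsupp.mem_support_iff.1 h0)⟩, rfl⟩
  refine ⟨c, hδ.isConjInvariant fun s => ?_, component_ext fun h => ?_⟩
  · rw [ha, Finsupp.single_eq_of_ne (ne_one_of_mem_complexReflections s.2), zero_smul, zero_add]
    rfl
  · rw [component_deltaTC, hc, ha]
    rfl

theorem exists_eq_deltaTC [FiniteDimensional k V]
    (hEnd : ∀ L : Module.End k V, (∀ g : G, Commute L (naturalRep G g)) → ∃ t : k, L = t • 1)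
    (hδ : IsYetterDrinfeld (naturalRep G) δ)
    (hV : ∀ f, HasSymmetricCommutators (naturalRep G) (pairing δ f))
    (hD : ∀ v, HasSymmetricCommutators (fun h => (naturalRep G h).dualMap) (pairing δ · v)) :
    ∃ (t : k) (c : complexReflections G →₀ k), IsConjInvariant G c ∧ δ = deltaTC G t c := by
  obtain ⟨t, ht⟩ := hEnd _ hδ.commute_component_one
  have hL : ∀ h : G, ∃ a : k,
      component δ h = Finsupp.single 1 t h • 1 + a • (1 - naturalRep G h) ∧
        (a ≠ 0 → h ∈ complexReflections G) := by
    intro h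
    rcases eq_or_ne h 1 with rfl | h1
    · exact ⟨0, by simp [ht], fun h0 => absurd rfl h0⟩
    · obtain ⟨a, ha, hrank⟩ :=
        (hasSymmetricCommutators_iff_component (naturalRep_injective G)).1 ⟨hV, hD⟩ h h1
      exact ⟨a, by rw [Finsupp.single_eq_of_ne h1, zero_smul, zero_add, ha], hrank⟩
  choose a ha hmem using hL
  have hsupp : Function.support a ⊆ {h | component δ h ≠ 0} := by
    intro h h0
    have hs := hmem h h0
    change component δ h ≠ 0
    rw [ha, Finsupp.single_eq_of_ne (ne_one_of_mem_complexReflections hs), zero_smul, zero_add]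
    exact smul_ne_zero h0 (one_sub_naturalRep_ne_zero hs)
  exact ⟨t, exists_eq_deltaTC_of_component_eq hδ ha
    ((finite_setOf_component_ne_zero δ).subset hsupp) hmem⟩

end DeltaTC

section SymmetricDoubles

variable {k V : Type*} [Field k] [AddCommGroup V] [Module k V]

theorem BraidedDouble.IsSymmetric.mul_comm_uminus {G : Type*} [Group G] {ρ : Representation k G V}
    {δ : V →ₗ[k] MonoidAlgebra k G ⊗[k] V} {B : BraidedDouble ρ δ} (hB : B.IsSymmetric)
    (x y : B.Uminus) : x * y = y * x :=
  mul_comm_quotient_of_eq_ker_algHom hB.1 x y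

theorem BraidedDouble.IsSymmetric.mul_comm_uplus {G : Type*} [Group G] {ρ : Representation k G V}
    {δ : V →ₗ[k] MonoidAlgebra k G ⊗[k] V} {B : BraidedDouble ρ δ} (hB : B.IsSymmetric)
    (x y : B.Uplus) : x * y = y * x :=
  mul_comm_quotient_of_eq_ker_algHom hB.2 x y

variable {G : Subgroup (LinearMap.GeneralLinearGroup k V)}

theorem exists_isSymmetric_braidedDouble (t : k) {c : complexReflections G →₀ k}
    (hc : IsConjInvariant G c) :
    ∃ B : BraidedDouble (naturalRep G) (deltaTC G t c), B.IsSymmetric :=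
  have ⟨hV, hD⟩ := hasSymmetricCommutators_deltaTC t c
  ⟨.ofHasSymmetricCommutators (isYetterDrinfeld_deltaTC t hc) hV hD, rfl, rfl⟩

theorem exists_commutative_braidedDouble_iff [FiniteDimensional k V]
    (hirr : (naturalRep G).IsIrreducible)
    (hEnd : ∀ L : Module.End k V, (∀ g : G, Commute L (naturalRep G g)) → ∃ t : k, L = t • 1)
    (δ : V →ₗ[k] MonoidAlgebra k G ⊗[k] V) :
    (∃ B : BraidedDouble (naturalRep G) δ,
        (∀ x y : B.Uminus, x * y = y * x) ∧ (∀ x y : B.Uplus, x * y = y * x)) ↔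
      ∃ (t : k) (c : complexReflections G →₀ k), IsConjInvariant G c ∧ δ = deltaTC G t c := by
  constructor
  · rintro ⟨B, hminus, hplus⟩
    exact exists_eq_deltaTC hEnd B.yetterDrinfeld
      (BraidedDouble.hasSymmetricCommutators_minus hirr hminus)
      (BraidedDouble.hasSymmetricCommutators_plus hirr hplus)
  · rintro ⟨t, c, hc, rfl⟩
    obtain ⟨B, hB⟩ := exists_isSymmetric_braidedDouble t hc
    exact ⟨B, hB.mul_comm_uminus, hB.mul_comm_uplus⟩

end SymmetricDoubles

end BraidedDoubles

end

open BraidedDoubles in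
theorem mainTheorem3_general {k : Type*} {V : Type*} [Field k] [AddCommGroup V] [Module k V]
    (G : Subgroup (LinearMap.GeneralLinearGroup k V)) :
    (∀ [FiniteDimensional k V], (naturalRep G).IsIrreducible →
      (∀ L : Module.End k V, (∀ g : G, Commute L (naturalRep G g)) → ∃ t : k, L = t • 1) →
        ∀ δ : V →ₗ[k] TensorProduct k (MonoidAlgebra k G) V,
          (∃ B : BraidedDouble (naturalRep G) δ,
              (∀ x y : B.Uminus, x * y = y * x) ∧ (∀ x y : B.Uplus, x * y = y * x)) ↔
            ∃ (t : k) (c : complexReflections G →₀ k),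
              IsConjInvariant G c ∧ δ = deltaTC G t c) ∧
    (∀ (t : k) (c : complexReflections G →₀ k), IsConjInvariant G c →
      ∃ B : BraidedDouble (naturalRep G) (deltaTC G t c), B.IsSymmetric) :=
  ⟨exists_commutative_braidedDouble_iff, fun t _ hc => exists_isSymmetric_braidedDouble t hc⟩

open BraidedDoubles in
theorem mainTheorem3 {k : Type*} {V : Type*} [Field k] [AddCommGroup V] [Module k V]
    [FiniteDimensional k V] (G : Subgroup (LinearMap.GeneralLinearGroup k V))
    (hirr : (naturalRep G).IsIrreducible) :
    -- part 1, when Schur's lemma gives `End_{kG}(V) = k`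
    ((∀ L : Module.End k V, (∀ g : G, Commute L (naturalRep G g)) → ∃ t : k, L = t • 1) →
      ∀ δ : V →ₗ[k] TensorProduct k (MonoidAlgebra k G) V,
        (∃ B : BraidedDouble (naturalRep G) δ,
            (∀ x y : B.Uminus, x * y = y * x) ∧ (∀ x y : B.Uplus, x * y = y * x)) ↔
          ∃ (t : k) (c : complexReflections G →₀ k),
            IsConjInvariant G c ∧ δ = deltaTC G t c) ∧
    -- part 2
    (∀ (t : k) (c : complexReflections G →₀ k), IsConjInvariant G c →
      ∃ B : BraidedDouble (naturalRep G) (deltaTC G t c), B.IsSymmetric) := by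
  obtain ⟨classification, existence⟩ := mainTheorem3_general G
  exact ⟨classification hirr, existence⟩
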